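/- All spaces are Banach spaces over the same scalar field $\mathbb K\in\{\mathbb R,\mathbb C\}$ and operators are bounded and linear. **Trees.** Finite sequences in a set are ordered by $s\preceq t$ iff $s$ is an initial segment of $t$; $s^-$ denotes $s$ with its last term removed. A $B$-tree is a set $B$ of non-empty finite sequences such that $B\cup\{\varnothing\}$ is closed under initial segments. For a set $T$ of finite sequences put $T^0=T$, $T^{\zeta+1}=T^\zeta\setminus MAX(T^\zeta)$, and $T^\zeta=\bigcap_{\eta<\zeta}T^\eta$ for limit $\zeta$; if $T^\zeta=\varnothing$ for some $\zeta$, $o(T)$ is the least such $\zeta$. A collection $(x_t)_{t\in B}$ in $X$ is weakly null if for every ordinal $\zeta$ and every $t\in(B\cup\{\varnothing\})^{\zeta+1}$, $0$ is in the weak closure of $\{x_s: s\in B^\zeta,\ s^-=t\}$. **Moduli.** Let $A:X\to Y$ be an operator, $\xi$ an ordinal and $\sigma>0$. For $y\in Y$, a $B$-tree $B$ with $o(B)=\omega^\xi$ and a weakly null collection $(x_t)_{t\in B}\subset\sigma B_X$, put $$N(y,(x_t))=\inf\{\|y+Ax\|: t\in B,\ x\in\mathrm{co}(x_s:s\preceq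 t)\}.$$ Let $\rho_\xi(\sigma;A)=\sup (N(y,(x_t))-1)$ over all $y\in B_Y$ and all such $B$ and $(x_t)_{t\in B}\subset\sigma B_X$. For $1<p<\infty$, $A$ is $\xi$-AUS with power type $p$ if there is $C$ with $\rho_\xi(\sigma;A)\le C\sigma^p$ for all $0<\sigma\le1$; $A$ is $\xi$-AUS with power type $\infty$ if there is $C$ with $N(y,(x_t))\le\max\{\|y\|,C\sigma\}$ for all $\sigma>0$, $y\in Y$ and all such $(x_t)_{t\in B}\subset\sigma B_X$. Let $\mathbf t_{\xi,p}(A)\in[0,\infty]$ be the infimum of those $C>0$ such that $N(y,(x_t))^p\le\|y\|^p+C\sigma^p$ for all $\sigma>0$, $y\in Y$ and all such $(x_t)_{t\in B}\subset\sigma B_X$ (and $\infty$ if there is no such $C$); $\mathbf t_{\xi,\infty}(A)$ is defined in the same way with $N(y,(x_t))\le\max\{\|y\|,C\sigma\}$. **Szlenk index.** For $K\subset X^*$ and $\varepsilon>0$ let $s_\varepsilon(K)$ be the set of $x^*\in K$ such that $\mathrm{diam}(V\cap K)>\varepsilon$ for every weak$^*$-neighbourhood $V$ of $x^*$; iterate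 transfinitely, with intersections at limit ordinals. $Sz(K,\varepsilon)$ is the least $\zeta$ with $s^\zeta_\varepsilon(K)=\varnothing$ ($\infty$ if there is none) and $Sz(A)=\sup_{\varepsilon>0}Sz(A^*B_{Y^*},\varepsilon)$. **Statement.** Let $\xi$ be an ordinal, $\Lambda$ a non-empty set, and for $\lambda\in\Lambda$ let $A_\lambda:X_\lambda\to Y_\lambda$ be an operator with $Sz(A_\lambda)\le\omega^{\xi+1}$. Suppose $\sup_\lambda\|A_\lambda\|<\infty$. (i) For $1<p\le q<\infty$ the following are equivalent for the diagonal operator $\oplus A_\lambda:(\oplus_\lambda X_\lambda)_{\ell_q(\Lambda)}\to(\oplus_\lambda Y_\lambda)_{\ell_q(\Lambda)}$: it is $\xi$-AUS with power type $p$; $\sup_\lambda\sup_{\sigma\in(0,1)}\rho_\xi(\sigma;A_\lambda)/\sigma^p<\infty$; $\sup_\lambda\mathbf t_{\xi,p}(A_\lambda)<\infty$. More precisely, $\mathbf t_{\xi,p}(\oplus A_\lambda)\le\sup_\lambda\max\{\|A_\lambda\|^p,\mathbf t_{\xi,p}(A_\lambda)\}$. (ii) $\oplus A_\lambda:(\oplus_\lambda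 X_\lambda)_{c_0(\Lambda)}\to(\oplus_\lambda Y_\lambda)_{c_0(\Lambda)}$ is $\xi$-AUS with power type $\infty$ if and only if $\sup_\lambda\mathbf t_{\xi,\infty}(A_\lambda)<\infty$, and $\mathbf t_{\xi,\infty}(\oplus A_\lambda)\le\sup_\lambda\max\{\|A_\lambda\|,\mathbf t_{\xi,\infty}(A_\lambda)\}$. -/

import Mathlib

open Set Filter Topology
open scoped ENNReal Ordinal

universe u v

noncomputable section

/-! ### Trees of finite sequences

Finite sequences in `Λ` are lists; `s <+: t` says that `s` is an initial segment of `t`, and the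
initial segment of `t` of length `i` is `t.take i`. -/

/-- The members of `S` that are maximal for the initial segment ordering. -/
def maxNodes {Λ : Type u} (S : Set (List Λ)) : Set (List Λ) :=
  {t | t ∈ S ∧ ∀ s ∈ S, t <+: s → s = t}

/-- The transfinite derivations: `T ^ 0 = T`, `T ^ (ζ + 1) = T ^ ζ \ MAX (T ^ ζ)`, and
intersections at limit ordinals. -/
def treeDeriv {Λ : Type u} (T : Set (List Λ)) (ζ : Ordinal.{u}) : Set (List Λ) :=
  Ordinal.limitRecOn ζ T (fun _ S => S \ maxNodes S) (fun ζ _ S => ⋂ (η) (h : η < ζ), S η h)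

/-- A `B`-tree: a set of non-empty finite sequences which together with the empty sequence is
closed under initial segments. -/
def IsBTree {Λ : Type u} (B : Set (List Λ)) : Prop :=
  [] ∉ B ∧ ∀ t ∈ insert [] B, ∀ s, s <+: t → s ∈ insert [] B

/-- `B` is well-founded and its order `o(B)` is `α`: the `α`-th derivation is the first one
that is empty. -/
def HasTreeOrder {Λ : Type u} (B : Set (List Λ)) (α : Ordinal.{u}) : Prop :=
  treeDeriv B α = ∅ ∧ ∀ β < α, (treeDeriv B β).Nonempty

section Operators

variable (𝕜 : Type v) [RCLike 𝕜]
variable {X Y : Type u} [NormedAddCommGroup X] [NormedSpace 𝕜 X]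
  [NormedAddCommGroup Y] [NormedSpace 𝕜 Y]

/-- The collection `(x t)`, `t ∈ B`, is weakly null: for every `ζ` and every
`t ∈ (B ∪ {∅}) ^ (ζ + 1)`, `0` is in the weak closure of the set of those `x s` for which
`s ∈ B ^ ζ` is an immediate successor of `t`. Values of `x` off `B` play no role. -/
def IsWeaklyNull {Λ : Type u} (B : Set (List Λ)) (x : List Λ → X) : Prop :=
  ∀ ζ : Ordinal.{u}, ∀ t ∈ treeDeriv (insert [] B) (ζ + 1),
    (0 : WeakSpace 𝕜 X) ∈
      closure (toWeakSpace 𝕜 X '' (x '' {s | s ∈ treeDeriv B ζ ∧ s ≠ [] ∧ s.dropLast = t}))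

/-- The convex hull of `x s`, where `s` runs through the non-empty initial segments of `t`. -/
def branchHull {Λ : Type u} (x : List Λ → X) (t : List Λ) : Set X :=
  {z | ∃ w : ℕ → ℝ, (∀ i, 0 ≤ w i) ∧ ∑ i ∈ Finset.range t.length, w i = 1 ∧
    z = ∑ i ∈ Finset.range t.length, (w i : 𝕜) • x (t.take (i + 1))}

/-- `B` is a `B`-tree with `o(B) = ω ^ ξ` and `(x t)`, `t ∈ B`, is a weakly null collection
in `σ B_X`. -/
structure IsNullTree (ξ : Ordinal.{u}) (σ : ℝ) {Λ : Type u} (B : Set (List Λ))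
    (x : List Λ → X) : Prop where
  isBTree : IsBTree B
  order : HasTreeOrder B (ω ^ ξ)
  weaklyNull : IsWeaklyNull 𝕜 B x
  norm_le : ∀ t ∈ B, ‖x t‖ ≤ σ

variable {𝕜}

/-- The set of numbers `‖y + A z‖` with `z ∈ co (x s : s ≼ t)`, `t ∈ B`. -/
def branchNorms (A : X →L[𝕜] Y) (y : Y) {Λ : Type u} (B : Set (List Λ)) (x : List Λ → X) :
    Set ℝ :=
  {r | ∃ t ∈ B, ∃ z ∈ branchHull 𝕜 x t, r = ‖y + A z‖}

/-- The modulus `ρ_ξ(σ; A)` of `ξ`-asymptotic uniform smoothness. The infimum is a real one, over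
a non-empty set which is bounded below; the supremum is taken in the extended reals. -/
def rhoMod (ξ : Ordinal.{u}) (A : X →L[𝕜] Y) (σ : ℝ) : EReal :=
  ⨆ (y : Y) (_ : ‖y‖ ≤ 1) (Λ : Type u) (B : Set (List Λ)) (x : List Λ → X)
    (_ : IsNullTree 𝕜 ξ σ B x), ((sInf ((fun r => r - 1) '' branchNorms A y B x) : ℝ) : EReal)

/-- `A` is `ξ`-AUS with power type `p`, for `1 < p < ∞`. -/
def IsAUSPowerType (ξ : Ordinal.{u}) (p : ℝ) (A : X →L[𝕜] Y) : Prop :=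
  ∃ C : ℝ, ∀ σ : ℝ, 0 < σ → σ ≤ 1 → rhoMod ξ A σ ≤ ((C * σ ^ p : ℝ) : EReal)

/-- `A` is `ξ`-AUS with power type `∞`. -/
def IsAUSPowerTypeTop (ξ : Ordinal.{u}) (A : X →L[𝕜] Y) : Prop :=
  ∃ C : ℝ, ∀ (y : Y) (b : ℝ), 0 < b → ∀ (Λ : Type u) (B : Set (List Λ)) (x : List Λ → X),
    IsNullTree 𝕜 ξ b B x → sInf (branchNorms A y B x) ≤ max ‖y‖ (C * b)

/-- `t_{ξ,p}(A) ∈ [0, ∞]` for `1 < p < ∞`; it is `∞` if there is no admissible constant. -/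
def tConst (ξ : Ordinal.{u}) (p : ℝ) (A : X →L[𝕜] Y) : ℝ≥0∞ :=
  sInf (ENNReal.ofReal '' {C : ℝ | 0 < C ∧ ∀ (y : Y) (σ : ℝ), 0 < σ →
    ∀ (Λ : Type u) (B : Set (List Λ)) (x : List Λ → X), IsNullTree 𝕜 ξ σ B x →
      sInf ((fun r => r ^ p) '' branchNorms A y B x) ≤ ‖y‖ ^ p + C * σ ^ p})

/-- `t_{ξ,∞}(A) ∈ [0, ∞]`; it is `∞` if there is no admissible constant. -/
def tConstTop (ξ : Ordinal.{u}) (A : X →L[𝕜] Y) : ℝ≥0∞ :=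
  sInf (ENNReal.ofReal '' {C : ℝ | 0 < C ∧ ∀ (y : Y) (σ : ℝ), 0 < σ →
    ∀ (Λ : Type u) (B : Set (List Λ)) (x : List Λ → X), IsNullTree 𝕜 ξ σ B x →
      sInf (branchNorms A y B x) ≤ max ‖y‖ (C * σ)})

/-! ### The Szlenk index -/

/-- The derivation `s_ε(K)`: those `f ∈ K` all of whose weak-star neighbourhoods `V` satisfy
`diam (V ∩ K) > ε` (norm diameter); `s_ε(K) = K` if `ε ≤ 0`. -/
def szlenkStep (ε : ℝ) (K : Set (StrongDual 𝕜 X)) : Set (StrongDual 𝕜 X) :=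
  {f | f ∈ K ∧ (0 < ε → ∀ V ∈ 𝓝 (StrongDual.toWeakDual f),
    ENNReal.ofReal ε < Metric.ediam ((StrongDual.toWeakDual ⁻¹' V) ∩ K))}

/-- The transfinite iterates `s_ε^ζ(K)`. -/
def szlenkDeriv (ε : ℝ) (K : Set (StrongDual 𝕜 X)) (ζ : Ordinal.{u}) : Set (StrongDual 𝕜 X) :=
  Ordinal.limitRecOn ζ K (fun _ S => szlenkStep ε S) (fun ζ _ S => ⋂ (η) (h : η < ζ), S η h)

/-- `Sz(K, ε)`, the least `ζ` with `s_ε^ζ(K) = ∅`, and `∞` (that is `⊤`) if there is none. -/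
def szlenkEps (K : Set (StrongDual 𝕜 X)) (ε : ℝ) : WithTop Ordinal.{u} :=
  sInf ((fun ζ : Ordinal.{u} => (ζ : WithTop Ordinal.{u})) '' {ζ | szlenkDeriv ε K ζ = ∅})

/-- `Sz(A)`: the supremum over `ε > 0` of `Sz(A^* B_{Y^*}, ε)`. -/
def szlenk (A : X →L[𝕜] Y) : WithTop Ordinal.{u} :=
  ⨆ (ε : ℝ) (_ : 0 < ε),
    szlenkEps ((fun g : StrongDual 𝕜 Y => g.comp A) '' Metric.closedBall 0 1) ε

end Operators

/-! ### Direct sums -/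

section Sums

variable {𝕜 : Type v} [RCLike 𝕜] {ι : Type u} {X Y : ι → Type u}
  [∀ i, NormedAddCommGroup (X i)] [∀ i, NormedSpace 𝕜 (X i)]
  [∀ i, NormedAddCommGroup (Y i)] [∀ i, NormedSpace 𝕜 (Y i)]

/-- The operator `⊕ A_i` between the `ℓ_q`-sums. -/
def lpSumMap (q : ℝ≥0∞) [Fact (1 ≤ q)] (A : ∀ i, X i →L[𝕜] Y i)
    (hA : BddAbove (range fun i => ‖A i‖)) : lp X q →L[𝕜] lp Y q :=
  lp.mapCLM q A (K := ⨆ i, ‖A i‖) (Real.iSup_nonneg fun i => norm_nonneg (A i))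
    (fun i => le_ciSup hA i)

variable (𝕜 X) in
/-- The `c_0`-sum of the spaces `X i`, as a subspace of their `ℓ_∞`-sum. -/
def c0Sum : Submodule 𝕜 (lp X ∞) where
  carrier := {f | Tendsto (fun i => ‖f i‖) cofinite (𝓝 0)}
  zero_mem' := by simpa using tendsto_const_nhds
  add_mem' := by
    intro f g hf hg
    simp only [mem_ofPred_eq] at hf hg ⊢
    refine squeeze_zero (fun i => norm_nonneg _) (fun i => ?_) (by simpa using hf.add hg)
    simpa using norm_add_le (f i) (g i)
  smul_mem' := by
    intro c f hf
    simp only [mem_ofPred_eq] at hf ⊢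
    simpa [norm_smul] using hf.const_mul ‖c‖

theorem lpSumMap_mem_c0Sum (A : ∀ i, X i →L[𝕜] Y i) (hA : BddAbove (range fun i => ‖A i‖))
    (f : c0Sum 𝕜 X) : lpSumMap ∞ A hA (f : lp X ∞) ∈ c0Sum 𝕜 Y := by
  have hf : Tendsto (fun i => ‖(f : lp X ∞) i‖) cofinite (𝓝 0) := f.2
  refine squeeze_zero (fun i => norm_nonneg _) (fun i => ?_)
    (by simpa using hf.const_mul (⨆ i, ‖A i‖))
  exact (A i).le_of_opNorm_le (le_ciSup hA i) _

/-- The operator `⊕ A_i` between the `c_0`-sums. -/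
def c0SumMap (A : ∀ i, X i →L[𝕜] Y i) (hA : BddAbove (range fun i => ‖A i‖)) :
    c0Sum 𝕜 X →L[𝕜] c0Sum 𝕜 Y :=
  ((lpSumMap ∞ A hA).comp (c0Sum 𝕜 X).subtypeL).codRestrict (c0Sum 𝕜 Y)
    (lpSumMap_mem_c0Sum A hA)

end Sums

end

/-! The heart of the matter is the upper estimate for the constant of the direct sum. Approximating
`y`, one may treat it as living on finitely many coordinates; on the others only `‖A_λ‖` matters.
Each remaining coordinate has good convex combinations along branches of its own null trees, but one
branch and one combination must serve all of them at once: this is `IsNullTree.exists_simultaneous`.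

It rests on a Ramsey principle. A weakly null tree of order `ω ^ ξ` amounts to surviving a game of
that length (`IsNullTree.survives`, `Survives.exists_isNullTree`): a smaller ordinal is prescribed,
and the answers are vectors found in every weak neighbourhood of `0`. If the moves have two colours
and the length is a natural sum of `a` and `b`, the game survives with length `a` in the first
colour or `b` in the second (`Survives.natSum_or`). Since `ω ^ ξ` is closed under natural sums
(`natSum_lt_opow`), finite colourings lose no length (`Survives.exists_colour`).

The principle is used twice. Colouring vectors by the approximate norms of their coordinates fixes a
bound `τ_j` for each coordinate `j`. If no combination were good in all coordinates, Hahn-Banach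
would separate the convex set of each branch from a product of balls of radii `R_j`; at each node
the functional `(f_j)` then has some `f_j ≠ 0` with `Re f_j(y_j + A_j x_j) ≥ ‖f_j‖ R_j`. Colouring
by `j` yields a null tree in `X_j` with `‖y_j + A_j z‖ ≥ R_j` on all its hulls, contrary to the
estimate for `A_j`.

The coordinate estimates are combined by Minkowski's inequality in `ℓ_{q/p}`, or by a maximum for
`c_0`. Conversely, coordinate inclusions are isometric and intertwine the operators, and rescaling
turns bounds on `ρ_ξ` into bounds on `t_{ξ,p}`. -/

noncomputable section

/-! ### Natural sums of ordinals -/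

/-- The natural (Hessenberg) sum of two ordinals. -/
def natSum (a b : Ordinal.{u}) : Ordinal.{u} :=
  sInf {c | (∀ x : Iio a, natSum x.1 b < c) ∧ ∀ y : Iio b, natSum a y.1 < c}
termination_by (a, b)
decreasing_by
  · exact Prod.Lex.left _ _ x.2
  · exact Prod.Lex.right _ y.2

theorem natSum_spec (a b : Ordinal.{u}) :
    (∀ x < a, natSum x b < natSum a b) ∧ ∀ y < b, natSum a y < natSum a b := by
  have hne : {c | (∀ x : Iio a, natSum x.1 b < c) ∧ ∀ y : Iio b, natSum a y.1 < c}.Nonempty := by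
    obtain ⟨c, hc⟩ := Ordinal.bddAbove_of_small (s := range fun x : Iio a => natSum x.1 b)
    obtain ⟨d, hd⟩ := Ordinal.bddAbove_of_small (s := range fun y : Iio b => natSum a y.1)
    exact ⟨max c d + 1,
      fun x => Order.lt_add_one_iff.2 ((hc (mem_range_self x)).trans (le_max_left _ _)),
      fun x => Order.lt_add_one_iff.2 ((hd (mem_range_self x)).trans (le_max_right _ _))⟩
  have h := csInf_mem hne
  rw [← natSum] at h
  exact ⟨fun x hx => h.1 ⟨x, hx⟩, fun y hy => h.2 ⟨y, hy⟩⟩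

theorem natSum_le {a b c : Ordinal.{u}} (h₁ : ∀ x < a, natSum x b < c)
    (h₂ : ∀ y < b, natSum a y < c) : natSum a b ≤ c := by
  rw [natSum]
  exact csInf_le' ⟨fun x => h₁ x.1 x.2, fun y => h₂ y.1 y.2⟩

theorem natSum_comm (a b : Ordinal.{u}) : natSum a b = natSum b a := by
  have key : ∀ a b : Ordinal.{u}, natSum a b ≤ natSum b a := by
    intro a
    induction a using WellFoundedLT.induction with
    | _ a iha =>
      intro b
      induction b using WellFoundedLT.induction with
      | _ b ihb =>
        exact natSum_le (fun x hx => (iha x hx b).trans_lt ((natSum_spec b a).2 x hx))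
          (fun y hy => (ihb y hy).trans_lt ((natSum_spec b a).1 y hy))
  exact le_antisymm (key a b) (key b a)

theorem exists_eq_opow_mul_add {ζ a : Ordinal.{u}} (h : a < ω ^ (ζ + 1)) :
    ∃ (m : ℕ) (a' : Ordinal.{u}), a' < ω ^ ζ ∧ a = ω ^ ζ * m + a' := by
  have hpos : (ω ^ ζ : Ordinal.{u}) ≠ 0 := (Ordinal.opow_pos _ Ordinal.omega0_pos).ne'
  rw [Ordinal.opow_add_one] at h
  obtain ⟨m, hm⟩ := Ordinal.lt_omega0.1 ((Ordinal.lt_mul_iff_div_lt hpos).1 h)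
  exact ⟨m, a % ω ^ ζ, Ordinal.mod_lt _ hpos, by rw [← hm, Ordinal.div_add_mod]⟩

/-- Decreasing one argument either lowers its coefficient of `ω ^ ζ`, and then the sum of the
remainders is absorbed because it stays below `ω ^ ζ`, or it keeps the coefficient and lowers the
remainder. -/
theorem natSum_opow_mul_add_le {ζ : Ordinal.{u}}
    (hζ : ∀ a < (ω ^ ζ : Ordinal.{u}), ∀ b < (ω ^ ζ : Ordinal.{u}), natSum a b < ω ^ ζ) :
    ∀ (a b : Ordinal.{u}) (m n : ℕ) (a' b' : Ordinal.{u}), a' < ω ^ ζ → b' < ω ^ ζ →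
      a = ω ^ ζ * m + a' → b = ω ^ ζ * n + b' →
      natSum a b ≤ ω ^ ζ * (m + n : ℕ) + natSum a' b' := by
  -- one half of the recursion, used for both arguments
  have aux : ∀ (x : Ordinal.{u}) (m n : ℕ) (a' b' : Ordinal.{u}), a' < ω ^ ζ → b' < ω ^ ζ →
      x < ω ^ ζ * m + a' →
      ∃ (k : ℕ) (x' : Ordinal.{u}), x' < ω ^ ζ ∧ x = ω ^ ζ * k + x' ∧
        ω ^ ζ * (k + n : ℕ) + natSum x' b' < ω ^ ζ * (m + n : ℕ) + natSum a' b' := by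
    intro x m n a' b' ha hb hx
    have hx1 : x < ω ^ (ζ + 1) := by
      refine hx.trans ?_
      calc ω ^ ζ * m + a' < ω ^ ζ * m + ω ^ ζ := (add_lt_add_iff_left _).2 ha
        _ = ω ^ ζ * (m + 1 : ℕ) := by push_cast; rw [mul_add_one]
        _ < ω ^ ζ * ω := mul_lt_mul_of_pos_left (Ordinal.natCast_lt_omega0 _)
            (Ordinal.opow_pos _ Ordinal.omega0_pos)
        _ = _ := (Ordinal.opow_add_one _ _).symm
    obtain ⟨k, x', hx', rfl⟩ := exists_eq_opow_mul_add hx1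
    refine ⟨k, x', hx', rfl, ?_⟩
    rcases lt_trichotomy k m with hkm | rfl | hkm
    · calc ω ^ ζ * (k + n : ℕ) + natSum x' b'
          < ω ^ ζ * (k + n : ℕ) + ω ^ ζ := (add_lt_add_iff_left _).2 (hζ _ hx' _ hb)
        _ = ω ^ ζ * (k + n + 1 : ℕ) := by push_cast; rw [mul_add_one]
        _ ≤ ω ^ ζ * (m + n : ℕ) := mul_le_mul_right (by exact_mod_cast (by omega)) _
        _ ≤ _ := le_self_add
    · exact (add_lt_add_iff_left _).2 ((natSum_spec a' b').1 x' ((add_lt_add_iff_left _).1 hx))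
    · exfalso
      refine hx.not_ge ?_
      calc ω ^ ζ * m + a' ≤ ω ^ ζ * m + ω ^ ζ := (add_le_add_iff_left _).2 ha.le
        _ = ω ^ ζ * (m + 1 : ℕ) := by push_cast; rw [mul_add_one]
        _ ≤ ω ^ ζ * k := mul_le_mul_right (by exact_mod_cast hkm) _
        _ ≤ _ := le_self_add
  intro a
  induction a using WellFoundedLT.induction with
  | _ a iha =>
    intro b
    induction b using WellFoundedLT.induction with
    | _ b ihb =>
      intro m n a' b' ha' hb' ha hb
      refine natSum_le (fun x hx => ?_) (fun y hy => ?_)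
      · obtain ⟨k, x', hx', hxe, hlt⟩ := aux x m n a' b' ha' hb' (ha ▸ hx)
        exact (iha x hx b k n x' b' hx' hb' hxe hb).trans_lt hlt
      · obtain ⟨k, y', hy', hye, hlt⟩ := aux y n m b' a' hb' ha' (hb ▸ hy)
        refine (ihb y hy m k a' y' ha' hy' ha hye).trans_lt ?_
        rwa [add_comm m k, natSum_comm a' y', add_comm m n, natSum_comm a' b']

theorem natSum_lt_opow (ξ : Ordinal.{u}) :
    ∀ a < (ω ^ ξ : Ordinal.{u}), ∀ b < (ω ^ ξ : Ordinal.{u}), natSum a b < ω ^ ξ := by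
  induction ξ using Ordinal.limitRecOn with
  | zero =>
    intro a ha b hb
    rw [Ordinal.opow_zero, Order.lt_one_iff] at *
    subst ha hb
    exact le_antisymm (natSum_le (by simp) (by simp)) bot_le
  | add_one ζ ih =>
    intro a ha b hb
    obtain ⟨m, a', ha', hae⟩ := exists_eq_opow_mul_add ha
    obtain ⟨n, b', hb', hbe⟩ := exists_eq_opow_mul_add hb
    calc natSum a b ≤ ω ^ ζ * (m + n : ℕ) + natSum a' b' :=
          natSum_opow_mul_add_le ih a b m n a' b' ha' hb' hae hbe
      _ < ω ^ ζ * (m + n : ℕ) + ω ^ ζ := (add_lt_add_iff_left _).2 (ih _ ha' _ hb')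
      _ = ω ^ ζ * (m + n + 1 : ℕ) := by push_cast; rw [mul_add_one]
      _ < ω ^ ζ * ω := mul_lt_mul_of_pos_left (Ordinal.natCast_lt_omega0 _)
            (Ordinal.opow_pos _ Ordinal.omega0_pos)
      _ = _ := (Ordinal.opow_add_one _ _).symm
  | limit ζ hζ ih =>
    intro a ha b hb
    obtain ⟨c, hc, hac⟩ := (Ordinal.lt_opow_of_isSuccLimit Ordinal.omega0_ne_zero hζ).1 ha
    obtain ⟨d, hd, hbd⟩ := (Ordinal.lt_opow_of_isSuccLimit Ordinal.omega0_ne_zero hζ).1 hb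
    have hmono : ∀ {x y : Ordinal.{u}}, x ≤ y → (ω ^ x : Ordinal.{u}) ≤ ω ^ y :=
      fun h => Ordinal.opow_le_opow_right Ordinal.omega0_pos h
    exact (ih (max c d) (max_lt hc hd) a (hac.trans_le (hmono (le_max_left _ _))) b
      (hbd.trans_le (hmono (le_max_right _ _)))).trans_le (hmono (max_lt hc hd).le)

/-! ### A game of ordinal length -/

/-- A set `S` of witnesses survives a game of length `a`: at each stage a smaller length is
prescribed, and there are frequently many moves `e` for which the witnesses accepting `e` survive
the game of that length. -/
def Survives {E : Type*} {Φ : Type*} (F : Filter E) (r : Φ → E → Prop) (S : Set Φ)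
    (a : Ordinal.{u}) : Prop :=
  S.Nonempty ∧ ∀ b : Iio a, ∃ᶠ e in F, Survives F r {φ ∈ S | r φ e} b.1
termination_by a
decreasing_by exact b.2

section Survives

variable {E : Type*} {Φ Ψ : Type*} {F : Filter E}

theorem survives_iff {r : Φ → E → Prop} {S : Set Φ} {a : Ordinal.{u}} :
    Survives F r S a ↔
      S.Nonempty ∧ ∀ b < a, ∃ᶠ e in F, Survives F r {φ ∈ S | r φ e} b := by
  rw [Survives]
  simp [Subtype.forall]

theorem Survives.nonempty {r : Φ → E → Prop} {S : Set Φ} {a : Ordinal.{u}}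
    (h : Survives F r S a) : S.Nonempty := (survives_iff.1 h).1

theorem Survives.frequently {r : Φ → E → Prop} {S : Set Φ} {a b : Ordinal.{u}}
    (h : Survives F r S a) (hb : b < a) : ∃ᶠ e in F, Survives F r {φ ∈ S | r φ e} b :=
  (survives_iff.1 h).2 b hb

theorem exists_of_not_survives {r : Φ → E → Prop} {S : Set Φ} {a : Ordinal.{u}}
    (h : ¬ Survives F r S a) (hS : S.Nonempty) :
    ∃ b < a, ∀ᶠ e in F, ¬ Survives F r {φ ∈ S | r φ e} b := by
  by_contra! hcon
  exact h (survives_iff.2 ⟨hS, fun b hb => hcon b hb⟩)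

theorem survives_zero {r : Φ → E → Prop} {S : Set Φ} :
    Survives F r S (0 : Ordinal.{u}) ↔ S.Nonempty := by
  rw [survives_iff]
  simp

theorem survives_one {r : Φ → E → Prop} {S : Set Φ} :
    Survives F r S (1 : Ordinal.{u}) ↔ ∃ᶠ e in F, {φ ∈ S | r φ e}.Nonempty := by
  rw [survives_iff]
  simp only [Order.lt_one_iff, forall_eq, survives_zero, and_iff_right_iff_imp]
  intro h
  obtain ⟨e, he⟩ := h.exists
  exact he.mono (sep_subset _ _)

theorem Survives.mono {r : Φ → E → Prop} {S : Set Φ} {a b : Ordinal.{u}}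
    (h : Survives F r S a) (hb : b ≤ a) : Survives F r S b :=
  survives_iff.2 ⟨h.nonempty, fun _ hc => h.frequently (hc.trans_le hb)⟩

/-- A witness may be exchanged for one that accepts at least the same moves. This is how branches
are replaced by functionals. -/
theorem Survives.transfer {r : Φ → E → Prop} {r' : Ψ → E → Prop} {a : Ordinal.{u}} :
    ∀ {S : Set Φ} {S' : Set Ψ}, Survives F r S a →
      (∀ φ ∈ S, ∃ ψ ∈ S', ∀ e, r φ e → r' ψ e) → Survives F r' S' a := by
  induction a using WellFoundedLT.induction with
  | _ a ih =>
    intro S S' h hS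
    refine survives_iff.2 ⟨?_, fun b hb => (h.frequently hb).mono fun e he => ?_⟩
    · obtain ⟨φ, hφ⟩ := h.nonempty
      obtain ⟨ψ, hψ, -⟩ := hS φ hφ
      exact ⟨ψ, hψ⟩
    · refine ih b hb he fun φ hφ => ?_
      obtain ⟨ψ, hψ, hr⟩ := hS φ hφ.1
      exact ⟨ψ, ⟨hψ, hr e hφ.2⟩, hr⟩

theorem Survives.mono_set {r : Φ → E → Prop} {S S' : Set Φ} {a : Ordinal.{u}}
    (h : Survives F r S a) (hS : S ⊆ S') : Survives F r S' a :=
  h.transfer fun φ hφ => ⟨φ, hS hφ, fun _ => id⟩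

/-- If both parts fail, each is defeated by some prescribed length; prescribing the larger one
defeats the union, by induction. No length is lost when the witnesses, rather than the moves, are
split. -/
theorem Survives.union {r : Φ → E → Prop} {a : Ordinal.{u}} :
    ∀ {S S' : Set Φ}, Survives F r (S ∪ S') a → Survives F r S a ∨ Survives F r S' a := by
  induction a using WellFoundedLT.induction with
  | _ a ih =>
    intro S S' h
    by_contra! hcon
    obtain ⟨h₁, h₂⟩ := hcon
    rcases eq_or_ne a 0 with rfl | ha
    · rw [survives_zero] at h h₁ h₂
      rcases h with ⟨φ, hφ | hφ⟩
      · exact h₁ ⟨φ, hφ⟩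
      · exact h₂ ⟨φ, hφ⟩
    -- An empty part has to be treated apart: it is defeated by prescribing the length `0`,
    -- available since `a ≠ 0`.
    have key : ∀ {T : Set Φ}, ¬ Survives F r T a →
        ∃ b < a, ∀ᶠ e in F, ¬ Survives F r {φ ∈ T | r φ e} b := by
      intro T hT
      rcases T.eq_empty_or_nonempty with rfl | hT'
      · refine ⟨0, pos_iff_ne_zero.2 ha, Eventually.of_forall fun e he => ?_⟩
        simpa using he.nonempty
      · exact exists_of_not_survives hT hT'
    obtain ⟨b, hb, hb'⟩ := key h₁
    obtain ⟨c, hc, hc'⟩ := key h₂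
    obtain ⟨e, he, hbe, hce⟩ :=
      ((h.frequently (max_lt hb hc)).and_eventually (hb'.and hc')).exists
    have : {φ ∈ S ∪ S' | r φ e} = {φ ∈ S | r φ e} ∪ {φ ∈ S' | r φ e} := by
      ext φ; simp [or_and_right]
    rw [this] at he
    rcases ih _ (max_lt hb hc) he with h | h
    · exact hbe (h.mono (le_max_left _ _))
    · exact hce (h.mono (le_max_right _ _))

/-- Let `a'` and `b'` be prescriptions defeating the two colours. Prescribe the larger of `natSum a'
b` and `natSum a b'`. After a move, the witnesses split according to the colour they give it, one
part survives, and induction contradicts the choice of `a'` or `b'` or the failure of the other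
colour. -/
theorem Survives.natSum_or {r r₁ r₂ : Φ → E → Prop} (hr : ∀ φ e, r φ e → r₁ φ e ∨ r₂ φ e)
    (a b : Ordinal.{u}) : ∀ {S : Set Φ}, Survives F r S (natSum a b) →
      Survives F r₁ S a ∨ Survives F r₂ S b := by
  induction a using WellFoundedLT.induction generalizing b with
  | _ a iha =>
  induction b using WellFoundedLT.induction with
  | _ b ihb =>
    intro S h
    by_contra! hcon
    obtain ⟨h₁, h₂⟩ := hcon
    obtain ⟨a', ha, ha'⟩ := exists_of_not_survives h₁ h.nonempty
    obtain ⟨b', hb, hb'⟩ := exists_of_not_survives h₂ h.nonempty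
    obtain ⟨e, he, hae, hbe⟩ := ((h.frequently (max_lt ((natSum_spec a b).1 a' ha)
      ((natSum_spec a b).2 b' hb))).and_eventually (ha'.and hb')).exists
    have hsub : {φ ∈ S | r φ e} ⊆ {φ ∈ S | r₁ φ e} ∪ {φ ∈ S | r₂ φ e} :=
      fun φ hφ => (hr φ e hφ.2).imp (fun h => ⟨hφ.1, h⟩) (fun h => ⟨hφ.1, h⟩)
    rcases (he.mono_set hsub).union with h | h
    · rcases iha a' ha b (h.mono (le_max_left _ _)) with h | h
      · exact hae h
      · exact h₂ (h.mono_set (sep_subset _ _))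
    · rcases ihb b' hb (h.mono (le_max_right _ _)) with h | h
      · exact h₁ (h.mono_set (sep_subset _ _))
      · exact hbe h

theorem Survives.opow_or {r r₁ r₂ : Φ → E → Prop} (hr : ∀ φ e, r φ e → r₁ φ e ∨ r₂ φ e)
    {ξ : Ordinal.{u}} {S : Set Φ} (h : Survives F r S (ω ^ ξ)) :
    Survives F r₁ S (ω ^ ξ) ∨ Survives F r₂ S (ω ^ ξ) := by
  rcases eq_or_ne ξ 0 with rfl | hξ
  · simp only [Ordinal.opow_zero, survives_one] at h ⊢
    rw [← frequently_or_distrib]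
    refine h.mono fun e he => ?_
    obtain ⟨φ, hφ, hr'⟩ := he
    exact (hr φ e hr').imp (fun h => ⟨φ, hφ, h⟩) (fun h => ⟨φ, hφ, h⟩)
  · by_contra! hcon
    obtain ⟨h₁, h₂⟩ := hcon
    -- For `ξ ≠ 0` the length is a limit, so a failure already occurs at a smaller length: one more
    -- than the defeating prescription.
    have key : ∀ {r' : Φ → E → Prop}, ¬ Survives F r' S (ω ^ ξ) →
        ∃ a < ω ^ ξ, ¬ Survives F r' S a := by
      intro r' hr'
      obtain ⟨a, ha, ha'⟩ := exists_of_not_survives hr' h.nonempty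
      refine ⟨a + 1, (Ordinal.isSuccLimit_opow_left Ordinal.isSuccLimit_omega0 hξ).add_one_lt ha,
        fun hc => ?_⟩
      exact hc.frequently (lt_add_one a) ha'
    obtain ⟨a, ha, ha'⟩ := key h₁
    obtain ⟨b, hb, hb'⟩ := key h₂
    rcases (h.mono (natSum_lt_opow ξ a ha b hb).le).natSum_or hr a b with h | h
    · exact ha' h
    · exact hb' h

/-- Ramsey property: if each accepted move has one of finitely many colours, then the game is
survived with all moves of one colour. -/
theorem Survives.exists_colour {κ : Type*} {r : Φ → E → Prop} {r' : κ → Φ → E → Prop}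
    {ξ : Ordinal.{u}} {S : Set Φ} (K : Finset κ) (hr : ∀ φ e, r φ e → ∃ k ∈ K, r' k φ e)
    (h : Survives F r S (ω ^ ξ)) : ∃ k ∈ K, Survives F (r' k) S (ω ^ ξ) := by
  classical
  induction K using Finset.induction_on generalizing r with
  | empty =>
    obtain ⟨e, he⟩ := (h.frequently (Ordinal.opow_pos ξ Ordinal.omega0_pos)).exists
    obtain ⟨φ, -, hφ⟩ := he.nonempty
    simpa using hr φ e hφ
  | insert k K hk ih =>
    rcases h.opow_or (r₁ := r' k) (r₂ := fun φ e => ∃ k ∈ K, r' k φ e) (fun φ e he => by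
      simpa using hr φ e he) with h | h
    · exact ⟨k, Finset.mem_insert_self _ _, h⟩
    · obtain ⟨l, hl, h⟩ := ih (fun _ _ => id) h
      exact ⟨l, Finset.mem_insert_of_mem hl, h⟩

end Survives

/-! ### Derived trees and rank functions -/

section Trees

variable {Λ : Type u}

theorem treeDeriv_zero (T : Set (List Λ)) : treeDeriv T 0 = T :=
  Ordinal.limitRecOn_zero _ _ _

theorem treeDeriv_add_one (T : Set (List Λ)) (ζ : Ordinal.{u}) :
    treeDeriv T (ζ + 1) = treeDeriv T ζ \ maxNodes (treeDeriv T ζ) :=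
  Ordinal.limitRecOn_add_one _ _ _ _

theorem treeDeriv_limit (T : Set (List Λ)) {ζ : Ordinal.{u}} (hζ : Order.IsSuccLimit ζ) :
    treeDeriv T ζ = ⋂ (η) (_ : η < ζ), treeDeriv T η :=
  Ordinal.limitRecOn_limit _ _ _ _ hζ

theorem sdiff_maxNodes_mono {S T : Set (List Λ)} (h : S ⊆ T) :
    S \ maxNodes S ⊆ T \ maxNodes T := by
  rintro t ⟨ht, hmax⟩
  exact ⟨h ht, fun hT => hmax ⟨ht, fun s hs => hT.2 s (h hs)⟩⟩

theorem treeDeriv_mono {S T : Set (List Λ)} (h : S ⊆ T) (ζ : Ordinal.{u}) :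
    treeDeriv S ζ ⊆ treeDeriv T ζ := by
  induction ζ using Ordinal.limitRecOn with
  | zero => simpa only [treeDeriv_zero]
  | add_one ζ ih => simpa only [treeDeriv_add_one] using sdiff_maxNodes_mono ih
  | limit ζ hζ ih =>
    simp only [treeDeriv_limit _ hζ]
    exact iInter₂_mono ih

theorem treeDeriv_antitone (T : Set (List Λ)) : Antitone (treeDeriv T) := by
  intro a b hab
  induction b using Ordinal.limitRecOn with
  | zero => rw [nonpos_iff_eq_zero.1 hab]
  | add_one b ih =>
    rcases hab.lt_or_eq with h | rfl
    · rw [treeDeriv_add_one]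
      exact sdiff_subset.trans (ih (Order.lt_add_one_iff.1 h))
    · exact le_rfl
  | limit b hb ih =>
    rcases hab.lt_or_eq with h | rfl
    · rw [treeDeriv_limit _ hb]
      exact iInter₂_subset a h
    · exact le_rfl

/-- Since every rank below that of a node is attained at an immediate successor, the nodes removed
at stage `ζ` are exactly those of rank `ζ`. -/
theorem treeDeriv_eq_of_rank {T : Set (List Λ)} {rk : List Λ → Ordinal.{u}}
    (hlt : ∀ s ∈ T, ∀ t ∈ T, s <+: t → t ≠ s → rk t < rk s)
    (hex : ∀ t ∈ T, ∀ γ < rk t, ∃ a, t ++ [a] ∈ T ∧ rk (t ++ [a]) = γ) (ζ : Ordinal.{u}) :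
    treeDeriv T ζ = {t ∈ T | ζ ≤ rk t} := by
  induction ζ using Ordinal.limitRecOn with
  | zero => simp [treeDeriv_zero]
  | add_one ζ ih =>
    rw [treeDeriv_add_one, ih]
    ext t
    simp only [maxNodes, Set.mem_sdiff, mem_ofPred_eq, not_and, not_forall, Order.add_one_le_iff]
    constructor
    · rintro ⟨⟨ht, hζ⟩, h⟩
      obtain ⟨s, hs, hts, hne⟩ := h ⟨ht, hζ⟩
      exact ⟨ht, hs.2.trans_lt (hlt t ht s hs.1 hts hne)⟩
    · rintro ⟨ht, hζ⟩
      refine ⟨⟨ht, hζ.le⟩, fun _ => ?_⟩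
      obtain ⟨a, ha, hrk⟩ := hex t ht ζ hζ
      exact ⟨t ++ [a], ⟨ha, hrk.ge⟩, List.prefix_append _ _, by simp⟩
  | limit ζ hζ ih =>
    rw [treeDeriv_limit _ hζ]
    ext t
    simp only [mem_iInter]
    constructor
    · intro h
      have h0 := h 0 hζ.bot_lt
      rw [treeDeriv_zero] at h0
      refine ⟨h0, (Order.IsSuccLimit.le_iff_forall_le hζ).2 fun η hη => ?_⟩
      have := h η hη
      rw [ih η hη] at this
      exact this.2
    · rintro ⟨ht, hle⟩ η hη
      rw [ih η hη]
      exact ⟨ht, hη.le.trans hle⟩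

/-- The root is not maximal while the derivation of `B` still has a node above it. Hence it is a
legitimate starting position for the game of length `o(B)`. -/
theorem nil_mem_treeDeriv_insert {B : Set (List Λ)} (hB : IsBTree B) {α : Ordinal.{u}}
    (hα : ∀ β < α, (treeDeriv B β).Nonempty) : [] ∈ treeDeriv (insert [] B) α := by
  induction α using Ordinal.limitRecOn with
  | zero => simp [treeDeriv_zero]
  | add_one α ih =>
    rw [treeDeriv_add_one]
    refine ⟨ih fun β hβ => hα β (hβ.trans (lt_add_one α)), fun hmax => ?_⟩
    obtain ⟨s, hs⟩ := hα α (lt_add_one α)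
    have hsB : s ∈ B := by
      have := treeDeriv_antitone B bot_le hs
      rwa [Ordinal.bot_eq_zero, treeDeriv_zero] at this
    have := hmax.2 s (treeDeriv_mono (subset_insert _ _) α hs) List.nil_prefix
    exact hB.1 (this ▸ hsB)
  | limit α hlim ih =>
    rw [treeDeriv_limit _ hlim]
    exact mem_iInter₂.2 fun η hη => ih η hη fun β hβ => hα β (hβ.trans hη)

end Trees

/-- The rank of a list whose entries carry ordinal labels: the label of the last entry. -/
def lastLabel {M : Type*} (lab : M → Ordinal.{u}) (α : Ordinal.{u}) (t : List M) : Ordinal.{u} :=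
  t.getLast?.elim α lab

/-- The tree of all positions in the game `Survives F r S α`, the moves being labelled by
the lengths that remain. -/
def positionTree {E I : Type u} (lab : I → Ordinal.{u}) {Φ : Type*} (F : Filter E)
    (r : Φ → E → Prop) (S : Set Φ) (α : Ordinal.{u}) : Set (List (E × I)) :=
  {t | ∀ s a, s ++ [a] <+: t → lab a.2 < lastLabel (fun m => lab m.2) α s ∧
    Survives F r {φ ∈ S | ∀ e ∈ s ++ [a], r φ e.1} (lab a.2)}

section PositionTree

variable {E I : Type u} {lab : I → Ordinal.{u}} {Φ : Type*} {F : Filter E}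
  {r : Φ → E → Prop} {S : Set Φ} {α : Ordinal.{u}}

theorem nil_mem_positionTree : [] ∈ positionTree lab F r S α := by
  intro s a h
  simp at h

theorem positionTree_of_prefix {s t : List (E × I)} (ht : t ∈ positionTree lab F r S α)
    (h : s <+: t) : s ∈ positionTree lab F r S α :=
  fun s' a hs' => ht s' a (hs'.trans h)

theorem append_mem_positionTree {t : List (E × I)} {a : E × I}
    (ht : t ∈ positionTree lab F r S α) (hlt : lab a.2 < lastLabel (fun m => lab m.2) α t)
    (h : Survives F r {φ ∈ S | ∀ e ∈ t ++ [a], r φ e.1} (lab a.2)) :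
    t ++ [a] ∈ positionTree lab F r S α := by
  intro s b hs
  rcases List.prefix_concat_iff.1 hs with h' | h'
  · obtain ⟨rfl, hab⟩ := List.append_inj' h' rfl
    obtain rfl : b = a := by simpa using hab
    exact ⟨hlt, h⟩
  · exact ht s b h'

theorem positionTree_lastLabel_lt {s t : List (E × I)} (ht : t ∈ positionTree lab F r S α)
    (hst : s <+: t) (hne : t ≠ s) :
    lastLabel (fun m : E × I => lab m.2) α t < lastLabel (fun m => lab m.2) α s := by
  induction t using List.reverseRecOn with
  | nil => exact absurd (List.prefix_nil.1 hst).symm hne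
  | append_singleton t a ih =>
    have h := (ht t a List.prefix_rfl).1
    have hlast : lastLabel (fun m : E × I => lab m.2) α (t ++ [a]) = lab a.2 := by
      simp [lastLabel]
    rw [hlast]
    rcases List.prefix_concat_iff.1 hst with h' | h'
    · exact absurd h'.symm hne
    · rcases eq_or_ne t s with rfl | hts
      · exact h
      · exact h.trans (ih (positionTree_of_prefix ht (List.prefix_append _ _)) h' hts)

theorem positionTree_survives (h : Survives F r S α) {t : List (E × I)}
    (ht : t ∈ positionTree lab F r S α) :
    Survives F r {φ ∈ S | ∀ e ∈ t, r φ e.1} (lastLabel (fun m : E × I => lab m.2) α t) := by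
  rcases t.eq_nil_or_concat with rfl | ⟨t', a, rfl⟩
  · simpa [lastLabel] using h
  · rw [List.concat_eq_append] at ht ⊢
    simpa [lastLabel] using (ht t' a List.prefix_rfl).2

theorem positionTree_frequently (hlab : ∀ β < α, ∃ i, lab i = β) (h : Survives F r S α)
    {t : List (E × I)} (ht : t ∈ positionTree lab F r S α) {γ : Ordinal.{u}}
    (hγ : γ < lastLabel (fun m : E × I => lab m.2) α t) :
    ∃ᶠ e in F, ∃ i, lab i = γ ∧ t ++ [(e, i)] ∈ positionTree lab F r S α := by
  have hle : lastLabel (fun m : E × I => lab m.2) α t ≤ α := by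
    rcases eq_or_ne t [] with rfl | hne
    · simp [lastLabel]
    · exact (positionTree_lastLabel_lt ht List.nil_prefix hne).le.trans (by simp [lastLabel])
  obtain ⟨i, rfl⟩ := hlab γ (hγ.trans_le hle)
  refine ((positionTree_survives h ht).frequently hγ).mono fun e he => ⟨i, rfl, ?_⟩
  refine append_mem_positionTree ht hγ (he.mono_set ?_)
  rintro φ ⟨⟨hφ, hall⟩, hr⟩
  refine ⟨hφ, fun e' he' => ?_⟩
  rcases List.mem_append.1 he' with h' | h'
  · exact hall e' h'
  · rw [List.mem_singleton.1 h']
    exact hr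

end PositionTree

/-! ### Weakly null trees and the game on weak neighbourhoods of zero -/

section NullTrees

variable (𝕜 : Type v) [RCLike 𝕜] {E X : Type u} [NormedAddCommGroup E] [NormedSpace 𝕜 E]
  [NormedAddCommGroup X] [NormedSpace 𝕜 X]

variable (E) in
/-- The filter of weak neighbourhoods of `0`. -/
def weakNhdsZero : Filter E := comap (toWeakSpace 𝕜 E) (𝓝 0)

theorem tendsto_weakNhdsZero (π : E →L[𝕜] X) :
    Tendsto (fun e => toWeakSpace 𝕜 X (π e)) (weakNhdsZero 𝕜 E) (𝓝 0) := by
  have h : Tendsto (WeakSpace.map π) (𝓝 0) (𝓝 0) := by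
    have := (WeakSpace.map π).continuous.tendsto 0
    rwa [map_zero] at this
  exact h.comp tendsto_comap

variable {𝕜}

/-- The witnesses are the nodes `t`, each accepting the vectors on its branch. At a node of rank at
least `ζ`, a prescription `η < ζ` is answered by successors in the `η`-th derivation, which weak
nullity supplies near `0`. -/
theorem IsNullTree.survives {ξ : Ordinal.{u}} {σ : ℝ} {Λ : Type u} {B : Set (List Λ)}
    {x : List Λ → X} (h : IsNullTree 𝕜 ξ σ B x) :
    Survives (weakNhdsZero 𝕜 X) (fun t e => ∃ i < t.length, e = x (t.take (i + 1))) B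
      (ω ^ ξ : Ordinal.{u}) := by
  have hne : B.Nonempty := by
    have := h.order.2 0 (Ordinal.opow_pos ξ Ordinal.omega0_pos)
    rwa [treeDeriv_zero] at this
  have key : ∀ (ζ : Ordinal.{u}) (s : List Λ), s ∈ treeDeriv (insert [] B) ζ →
      Survives (weakNhdsZero 𝕜 X) (fun t e => ∃ i < t.length, e = x (t.take (i + 1)))
        {t ∈ B | s <+: t} ζ := by
    intro ζ
    induction ζ using WellFoundedLT.induction with
    | _ ζ ih =>
      intro s hs
      refine survives_iff.2 ⟨?_, fun η hη => ?_⟩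
      · have h0 := treeDeriv_antitone _ bot_le hs
        rw [Ordinal.bot_eq_zero, treeDeriv_zero] at h0
        rcases h0 with rfl | h0
        · obtain ⟨t, ht⟩ := hne
          exact ⟨t, ht, List.nil_prefix⟩
        · exact ⟨s, h0, List.prefix_rfl⟩
      · have hs' := treeDeriv_antitone _ (Order.add_one_le_of_lt hη) hs
        have hcl := mem_closure_iff_frequently.1 (h.weaklyNull η s hs')
        refine frequently_comap.2 (hcl.mono ?_)
        rintro _ ⟨_, ⟨s', ⟨hs'B, hs'ne, rfl⟩, rfl⟩, rfl⟩
        refine ⟨_, rfl, (ih η hη s' (treeDeriv_mono (subset_insert _ _) η hs'B)).mono_set ?_⟩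
        rintro t ⟨htB, ht⟩
        refine ⟨⟨htB, (List.dropLast_prefix s').trans ht⟩, s'.length - 1, ?_, ?_⟩
        · have := ht.length_le
          have := List.length_pos_iff.2 hs'ne
          omega
        · rw [Nat.sub_add_cancel (List.length_pos_iff.2 hs'ne),
            ← List.prefix_iff_eq_take.1 ht]
  exact (key _ [] (nil_mem_treeDeriv_insert h.isBTree h.order.2)).mono_set (sep_subset _ _)

/-- The nodes are the positions of the game. The label of a position, the length still to be played,
is its rank; so the order is the length of the game, and the frequent answers give weak nullity,
which `π` preserves. -/
theorem Survives.exists_isNullTree {Φ : Type*} {r : Φ → E → Prop} {S : Set Φ}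
    {ξ : Ordinal.{u}} (h : Survives (weakNhdsZero 𝕜 E) r S (ω ^ ξ : Ordinal.{u}))
    (π : E →L[𝕜] X) {σ : ℝ} (hσ : ∀ φ ∈ S, ∀ e, r φ e → ‖π e‖ ≤ σ) :
    ∃ (Λ : Type u) (B : Set (List Λ)) (x : List Λ → X), IsNullTree 𝕜 ξ σ B x ∧
      ∀ t ∈ B, ∃ φ ∈ S, ∀ i < t.length, ∃ e, r φ e ∧ x (t.take (i + 1)) = π e := by
  set α : Ordinal.{u} := ω ^ ξ with hα
  -- A copy in `Type u` of the ordinals below `α`, so that the moves form a type in the universe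
  -- required of tree labels.
  let I : Type u := Shrink.{u} (Iio α)
  let lab : I → Ordinal.{u} := fun i => ((equivShrink (Iio α)).symm i).1
  have hlab : ∀ β < α, ∃ i, lab i = β := fun β hβ => ⟨equivShrink (Iio α) ⟨β, hβ⟩, by simp [lab]⟩
  have hlab' : ∀ i, lab i < α := fun i => ((equivShrink (Iio α)).symm i).2
  let T : Set (List (E × I)) := positionTree lab (weakNhdsZero 𝕜 E) r S α
  let rk : List (E × I) → Ordinal.{u} := lastLabel (fun m => lab m.2) α
  let B : Set (List (E × I)) := T \ {[]}
  let x : List (E × I) → X := fun t => t.getLast?.elim 0 (fun a => π a.1)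
  have hxa : ∀ t a, x (t ++ [a]) = π a.1 := fun t a => by simp [x]
  have hT : insert [] B = T := by
    simp only [B, insert_sdiff_singleton]
    exact insert_eq_of_mem nil_mem_positionTree
  have hrka : ∀ t a, rk (t ++ [a]) = lab a.2 := fun t a => by simp [rk, lastLabel]
  have hlt : ∀ s ∈ T, ∀ t ∈ T, s <+: t → t ≠ s → rk t < rk s :=
    fun s _ t ht hst hne => positionTree_lastLabel_lt ht hst hne
  have hex : ∀ t ∈ T, ∀ γ < rk t, ∃ a, t ++ [a] ∈ T ∧ rk (t ++ [a]) = γ := by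
    intro t ht γ hγ
    obtain ⟨e, i, hi, he⟩ := (positionTree_frequently hlab h ht hγ).exists
    exact ⟨(e, i), he, by rw [hrka]; exact hi⟩
  have hderT : ∀ ζ, treeDeriv T ζ = {t ∈ T | ζ ≤ rk t} := treeDeriv_eq_of_rank hlt hex
  have hderB : ∀ ζ, treeDeriv B ζ = {t ∈ B | ζ ≤ rk t} :=
    treeDeriv_eq_of_rank (fun s hs t ht => hlt s hs.1 t ht.1) fun t ht γ hγ => by
      obtain ⟨a, ha, hrk⟩ := hex t ht.1 γ hγ
      exact ⟨a, ⟨ha, by simp⟩, hrk⟩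
  have hmem : ∀ t ∈ T, ∃ φ ∈ S, ∀ e ∈ t, r φ e.1 := fun t ht =>
    (positionTree_survives h ht).nonempty
  refine ⟨E × I, B, x, ⟨⟨by simp [B], ?_⟩, ⟨?_, ?_⟩, ?_, ?_⟩, ?_⟩
  · rw [hT]
    exact fun t ht s hs => positionTree_of_prefix ht hs
  · rw [hderB, eq_empty_iff_forall_notMem]
    rintro t ⟨⟨-, ht⟩, hle⟩
    obtain ⟨t', a, rfl⟩ := (t.eq_nil_or_concat).resolve_left ht
    rw [List.concat_eq_append, hrka] at hle
    exact hle.not_gt (hlab' _)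
  · intro β hβ
    obtain ⟨a, ha, hrk⟩ := hex [] nil_mem_positionTree β (by simpa [rk, lastLabel] using hβ)
    rw [hderB]
    exact ⟨_, ⟨ha, by simp⟩, hrk.ge⟩
  · intro ζ t ht
    rw [hT, hderT] at ht
    refine mem_closure_iff_frequently.2 ((tendsto_weakNhdsZero 𝕜 π).frequently ?_)
    refine (positionTree_frequently hlab h ht.1 (Order.add_one_le_iff.1 ht.2)).mono ?_
    rintro e ⟨i, hi, he⟩
    refine ⟨_, ⟨t ++ [(e, i)], ⟨?_, by simp, by simp⟩, rfl⟩, by rw [hxa]⟩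
    rw [hderB]
    exact ⟨⟨he, by simp⟩, by rw [hrka]; exact hi.ge⟩
  · rintro t ⟨ht, hne⟩
    obtain ⟨t', a, rfl⟩ := (t.eq_nil_or_concat).resolve_left hne
    obtain ⟨φ, hφ, hr⟩ := hmem _ ht
    rw [List.concat_eq_append, hxa]
    exact hσ φ hφ _ (hr a (by simp))
  · rintro t ⟨ht, -⟩
    obtain ⟨φ, hφ, hr⟩ := hmem t ht
    refine ⟨φ, hφ, fun i hi => ⟨t[i].1, hr _ (List.getElem_mem hi), ?_⟩⟩
    rw [List.take_add_one, List.getElem?_eq_getElem hi]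
    exact hxa _ _

end NullTrees

/-! ### Handling finitely many coordinates at the same time -/

section Simultaneous

variable {𝕜 : Type v} [RCLike 𝕜]

theorem exists_norm_lt_le_re_apply {Z : Type*} [NormedAddCommGroup Z] [NormedSpace 𝕜 Z]
    (f : Z →L[𝕜] 𝕜) {a R : ℝ} (hR : 0 < R) (h : a < ‖f‖ * R) :
    ∃ v, ‖v‖ < R ∧ a ≤ RCLike.re (f v) := by
  obtain ⟨x, hx, hax⟩ := f.exists_lt_apply_of_lt_opNorm ((div_lt_iff₀ hR).2 h)
  obtain ⟨c, hc, hcx⟩ := RCLike.exists_norm_eq_mul_self (f x)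
  refine ⟨((R : 𝕜) * c) • x, ?_, ?_⟩
  · rw [norm_smul, norm_mul, hc, RCLike.norm_ofReal, abs_of_pos hR, mul_one]
    exact mul_lt_of_lt_one_right hR hx
  · rw [map_smul, smul_eq_mul, mul_assoc, ← hcx, ← RCLike.ofReal_mul, RCLike.ofReal_re, mul_comm]
    exact ((div_lt_iff₀ hR).1 hax).le

/-- Hahn-Banach separation of `C` from a product of open balls. The ball product contains `0`, so
the separating level is positive and can be normalised to `1`. -/
theorem exists_functional_of_forall_exists_le {J : Type*} [Fintype J] {Y : J → Type*}
    [∀ j, NormedAddCommGroup (Y j)] [∀ j, NormedSpace 𝕜 (Y j)] {R : J → ℝ} (hR : ∀ j, 0 < R j)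
    {C : Set (∀ j, Y j)}
    (hC : ∀ v ∈ C, ∀ v' ∈ C, ∀ a b : ℝ, 0 ≤ a → 0 ≤ b → a + b = 1 →
      (a : 𝕜) • v + (b : 𝕜) • v' ∈ C)
    (hdisj : ∀ v ∈ C, ∃ j, R j ≤ ‖v j‖) :
    ∃ f : ∀ j, Y j →L[𝕜] 𝕜,
      (∀ v : ∀ j, Y j, (∀ j, ‖v j‖ < R j) → ∑ j, RCLike.re (f j (v j)) < 1) ∧
      ∀ v ∈ C, 1 ≤ ∑ j, RCLike.re (f j (v j)) := by
  classical
  let _ : NormedSpace ℝ (∀ j, Y j) := NormedSpace.restrictScalars ℝ 𝕜 _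
  have hsm : ∀ (a : ℝ) (v : ∀ j, Y j), a • v = (a : 𝕜) • v := fun _ _ => rfl
  have : IsScalarTower ℝ 𝕜 (∀ j, Y j) :=
    ⟨fun a b v => by rw [RCLike.real_smul_eq_coe_mul, mul_smul, hsm]⟩
  set s : Set (∀ j, Y j) := {v | ∀ j, ‖v j‖ < R j} with hs
  have hs₁ : Convex ℝ s := by
    intro v hv v' hv' a b ha hb hab j
    rw [hsm, hsm]
    calc ‖(a : 𝕜) • v j + (b : 𝕜) • v' j‖ ≤ a * ‖v j‖ + b * ‖v' j‖ := by
          refine (norm_add_le _ _).trans_eq ?_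
          rw [norm_smul, norm_smul, RCLike.norm_ofReal, RCLike.norm_ofReal, abs_of_nonneg ha,
            abs_of_nonneg hb]
      _ < R j := by
          have h1 := hv j
          have h2 := hv' j
          rcases ha.eq_or_lt with rfl | ha
          · obtain rfl : b = 1 := by linarith
            simpa using h2
          · have h3 := mul_lt_mul_of_pos_left h1 ha
            have h4 := mul_le_mul_of_nonneg_left h2.le hb
            have h5 : a * R j + b * R j = R j := by rw [← add_mul, hab, one_mul]
            linarith
  have hs₂ : IsOpen s := by
    simp only [hs, ofPred_forall]
    exact isOpen_iInter_of_finite fun j =>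
      isOpen_lt ((continuous_apply j).norm) continuous_const
  have hconv : Convex ℝ C := fun v hv v' hv' a b ha hb hab => hC v hv v' hv' a b ha hb hab
  have hd : Disjoint s C := by
    rw [Set.disjoint_left]
    intro v hv hv'
    obtain ⟨j, hj⟩ := hdisj v hv'
    exact (hv j).not_ge hj
  obtain ⟨f, t, hf₁, hf₂⟩ := RCLike.geometric_hahn_banach_open (𝕜 := 𝕜) hs₁ hs₂ hconv hd
  have ht : 0 < t := by
    have := hf₁ 0 (fun j => by simpa using hR j)
    simpa using this
  let g : ∀ j, Y j →L[𝕜] 𝕜 := fun j =>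
    ((t⁻¹ : ℝ) : 𝕜) • f.comp (ContinuousLinearMap.single 𝕜 Y j)
  have hg : ∀ v : ∀ j, Y j, ∑ j, RCLike.re (g j (v j)) = t⁻¹ * RCLike.re (f v) := by
    intro v
    have : f v = ∑ j, f (Pi.single j (v j)) := by
      rw [← map_sum, Finset.univ_sum_single]
    rw [this, map_sum, Finset.mul_sum]
    refine Finset.sum_congr rfl fun j _ => ?_
    simp only [g, _root_.smul_apply, smul_eq_mul, RCLike.re_ofReal_mul]
    rfl
  refine ⟨g, fun v hv => ?_, fun v hv => ?_⟩
  · rw [hg, inv_mul_lt_iff₀ ht, mul_one]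
    exact hf₁ v hv
  · rw [hg, le_inv_mul_iff₀ ht, mul_one]
    exact hf₂ v hv

theorem le_re_apply_of_mem_branchHull {X Y : Type u} [NormedAddCommGroup X] [NormedSpace 𝕜 X]
    [NormedAddCommGroup Y] [NormedSpace 𝕜 Y] {Λ : Type u} {x : List Λ → X} {t : List Λ} {z : X}
    (hz : z ∈ branchHull 𝕜 x t) (A : X →L[𝕜] Y) (y : Y) (f : Y →L[𝕜] 𝕜) {a : ℝ}
    (h : ∀ i < t.length, a ≤ RCLike.re (f (y + A (x (t.take (i + 1)))))) :
    a ≤ RCLike.re (f (y + A z)) := by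
  obtain ⟨w, hw, hw1, rfl⟩ := hz
  calc a = ∑ i ∈ Finset.range t.length, w i * a := by rw [← Finset.sum_mul, hw1, one_mul]
    _ ≤ ∑ i ∈ Finset.range t.length, w i * RCLike.re (f (y + A (x (t.take (i + 1))))) :=
        Finset.sum_le_sum fun i hi =>
          mul_le_mul_of_nonneg_left (h i (Finset.mem_range.1 hi)) (hw i)
    _ = _ := by
        simp only [map_add, map_sum, map_smul, smul_eq_mul, RCLike.re_ofReal_mul, mul_add,
          Finset.sum_add_distrib, ← Finset.sum_mul, hw1, one_mul]

theorem IsNullTree.take_mem {X : Type u} [NormedAddCommGroup X] [NormedSpace 𝕜 X]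
    {ξ : Ordinal.{u}} {σ : ℝ} {Λ : Type u} {B : Set (List Λ)} {x : List Λ → X}
    (h : IsNullTree 𝕜 ξ σ B x) {t : List Λ} (ht : t ∈ B) {i : ℕ} (hi : i < t.length) :
    t.take (i + 1) ∈ B := by
  refine (h.isBTree.2 t (mem_insert_of_mem _ ht) _ (List.take_prefix _ _)).resolve_left ?_
  rw [List.take_eq_nil_iff]
  rintro (h | rfl)
  · omega
  · simp at hi

/-- Were every combination of colour `k` bad in some coordinate, separating functionals and a second
colouring would give a single coordinate carrying a null tree all of whose branches are bad there.
-/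
theorem IsNullTree.exists_simultaneous {E : Type u} [NormedAddCommGroup E] [NormedSpace 𝕜 E]
    {J : Type*} [Fintype J] {X Y : J → Type u}
    [∀ j, NormedAddCommGroup (X j)] [∀ j, NormedSpace 𝕜 (X j)]
    [∀ j, NormedAddCommGroup (Y j)] [∀ j, NormedSpace 𝕜 (Y j)]
    (π : ∀ j, E →L[𝕜] X j) (A : ∀ j, X j →L[𝕜] Y j) (y : ∀ j, Y j)
    {κ : Type*} [Fintype κ] (c : E → κ) {τ R : κ → J → ℝ} (hR : ∀ k j, 0 < R k j)
    {ξ : Ordinal.{u}} {σ : ℝ} {Λ : Type u} {B : Set (List Λ)} {x : List Λ → E}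
    (hB : IsNullTree 𝕜 ξ σ B x) (hτ : ∀ t ∈ B, ∀ j, ‖π j (x t)‖ ≤ τ (c (x t)) j)
    (hcoord : ∀ k j (Λ' : Type u) (B' : Set (List Λ')) (x' : List Λ' → X j),
      IsNullTree 𝕜 ξ (τ k j) B' x' → ∃ r ∈ branchNorms (A j) (y j) B' x', r < R k j) :
    ∃ k, ∃ t ∈ B, ∃ w : ℕ → ℝ, (∀ i, 0 ≤ w i) ∧ ∑ i ∈ Finset.range t.length, w i = 1 ∧
      (∀ i < t.length, w i ≠ 0 → c (x (t.take (i + 1))) = k) ∧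
      ∀ j, ‖y j + A j (π j (∑ i ∈ Finset.range t.length, (w i : 𝕜) • x (t.take (i + 1))))‖
        < R k j := by
  classical
  obtain ⟨k, -, hk⟩ := hB.survives.exists_colour
    (r' := fun k (t : List Λ) e => (∃ i < t.length, e = x (t.take (i + 1))) ∧ c e = k) Finset.univ
    (fun φ e he => ⟨c e, Finset.mem_univ _, he, rfl⟩)
  refine ⟨k, ?_⟩
  by_contra! hcon
  let S : Set (∀ j, Y j →L[𝕜] 𝕜) :=
    {f | ∀ v : ∀ j, Y j, (∀ j, ‖v j‖ < R k j) → ∑ j, RCLike.re (f j (v j)) < 1}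
  have h₁ : Survives (weakNhdsZero 𝕜 E)
      (fun (f : ∀ j, Y j →L[𝕜] 𝕜) e => 1 ≤ ∑ j, RCLike.re (f j (y j + A j (π j e))) ∧
        ∀ j, ‖π j e‖ ≤ τ k j) S (ω ^ ξ : Ordinal.{u}) := by
    refine hk.transfer fun t ht => ?_
    obtain ⟨f, hf₁, hf₂⟩ := exists_functional_of_forall_exists_le (𝕜 := 𝕜) (hR k)
      (C := {v | ∃ w : ℕ → ℝ, (∀ i, 0 ≤ w i) ∧ ∑ i ∈ Finset.range t.length, w i = 1 ∧
        (∀ i < t.length, w i ≠ 0 → c (x (t.take (i + 1))) = k) ∧ v = fun j => y j +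
          A j (π j (∑ i ∈ Finset.range t.length, (w i : 𝕜) • x (t.take (i + 1))))}) (by
        rintro _ ⟨w, hw, hw1, hwc, rfl⟩ _ ⟨w', hw', hw1', hwc', rfl⟩ a b ha hb hab
        refine ⟨fun i => a * w i + b * w' i, fun i => ?_, ?_, fun i hi hne => ?_, ?_⟩
        · exact add_nonneg (mul_nonneg ha (hw i)) (mul_nonneg hb (hw' i))
        · rw [Finset.sum_add_distrib, ← Finset.mul_sum, ← Finset.mul_sum, hw1, hw1', mul_one,
            mul_one, hab]
        · by_cases h : w i = 0
          · by_cases h' : w' i = 0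
            · simp [h, h'] at hne
            · exact hwc' i hi h'
          · exact hwc i hi h
        · funext j
          have hab' : (a : 𝕜) + (b : 𝕜) = 1 := by exact_mod_cast hab
          simp only [Pi.add_apply, Pi.smul_apply, RCLike.ofReal_mul, add_smul,
            mul_smul, Finset.sum_add_distrib, ← Finset.smul_sum, map_add, map_smul, smul_add]
          nth_rw 3 [← one_smul 𝕜 (y j)]
          rw [← hab', add_smul]
          abel)
      (by
        rintro _ ⟨w, hw, hw1, hwc, rfl⟩
        exact hcon t ht w hw hw1 hwc)
    refine ⟨f, hf₁, ?_⟩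
    rintro _ ⟨⟨i, hi, rfl⟩, hc⟩
    -- A single node of colour `k` is itself an admissible combination, so the functional is at
    -- least `1` there.
    refine ⟨hf₂ _ ⟨Pi.single i 1, fun i' => ?_, ?_, fun i' hi' hne => ?_, ?_⟩, fun j => ?_⟩
    · rw [Pi.single_apply]
      split_ifs <;> norm_num
    · simp [hi]
    · rw [Pi.single_apply] at hne
      obtain rfl : i' = i := by by_contra h; simp [h] at hne
      exact hc
    · funext j
      rw [Finset.sum_eq_single i]
      · simp
      · intro b _ hb
        simp [hb]
      · intro h
        exact absurd (Finset.mem_range.2 hi) h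
    · rw [← hc]
      exact hτ _ (hB.take_mem ht hi) j
  -- The colouring principle quantifies over all witnesses; passing to the subtype makes the bound
  -- on the product of balls available for each of them.
  have h₂ : Survives (weakNhdsZero 𝕜 E)
      (fun (f : S) e => 1 ≤ ∑ j, RCLike.re (f.1 j (y j + A j (π j e))) ∧
        ∀ j, ‖π j e‖ ≤ τ k j) univ (ω ^ ξ : Ordinal.{u}) :=
    h₁.transfer fun f hf => ⟨⟨f, hf⟩, mem_univ _, fun _ => id⟩
  obtain ⟨j, -, hj⟩ := h₂.exists_colour (r' := fun j (f : S) e => f.1 j ≠ 0 ∧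
      ‖f.1 j‖ * R k j ≤ RCLike.re (f.1 j (y j + A j (π j e))) ∧ ‖π j e‖ ≤ τ k j) Finset.univ (by
    rintro ⟨f, hf⟩ e ⟨h1, hle⟩
    by_contra! hno
    -- If no coordinate has the desired colour, each summand is dominated by the value of `f j` at
    -- some point of its open ball, and the total is below `1`.
    have hv : ∀ j, ∃ v, ‖v‖ < R k j ∧
        RCLike.re (f j (y j + A j (π j e))) ≤ RCLike.re (f j v) := by
      intro j
      by_cases hfj : f j = 0
      · exact ⟨0, by simpa using hR k j, by simp [hfj]⟩
      · refine exists_norm_lt_le_re_apply (f j) (hR k j) ?_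
        by_contra! hge
        exact (hno j (Finset.mem_univ _) hfj hge).not_ge (hle j)
    choose v hv₁ hv₂ using hv
    exact (h1.trans (Finset.sum_le_sum fun j _ => hv₂ j)).not_gt (hf v hv₁))
  obtain ⟨Λ', B', x', hx', hbr⟩ := hj.exists_isNullTree (π j) (σ := τ k j)
    fun f _ e he => he.2.2
  obtain ⟨_, ⟨t, ht, z, hz, rfl⟩, hlt⟩ := hcoord k j Λ' B' x' hx'
  obtain ⟨f, -, hf⟩ := hbr t ht
  have hlen : 0 < t.length :=
    List.length_pos_iff.2 fun h => hx'.isBTree.1 (h ▸ ht)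
  -- Recording `f j ≠ 0` in the colour makes the final inequality strict.
  have hf0 : 0 < ‖f.1 j‖ := by
    obtain ⟨e, he, -⟩ := hf 0 hlen
    exact norm_pos_iff.2 he.1
  have := le_re_apply_of_mem_branchHull hz (A j) (y j) (f.1 j) (a := ‖f.1 j‖ * R k j)
    fun i hi => by
      obtain ⟨e, he, hxe⟩ := hf i hi
      rw [hxe]
      exact he.2.1
  have h3 : RCLike.re (f.1 j (y j + A j z)) ≤ ‖f.1 j‖ * ‖y j + A j z‖ :=
    (RCLike.re_le_norm _).trans ((f.1 j).le_opNorm _)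
  exact (mul_lt_mul_of_pos_left hlt hf0).not_ge (this.trans h3)

end Simultaneous

/-! ### The moduli and the branches of null trees -/

section Moduli

variable {𝕜 : Type v} [RCLike 𝕜]
variable {X Y X' Y' : Type u} [NormedAddCommGroup X] [NormedSpace 𝕜 X]
  [NormedAddCommGroup Y] [NormedSpace 𝕜 Y] [NormedAddCommGroup X'] [NormedSpace 𝕜 X']
  [NormedAddCommGroup Y'] [NormedSpace 𝕜 Y']

/-- The infimum of `branchNorms A y B x` is at most `d`. -/
def BranchInfLE (A : X →L[𝕜] Y) (y : Y) {Λ : Type u} (B : Set (List Λ)) (x : List Λ → X)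
    (d : ℝ) : Prop :=
  ∀ c, d < c → ∃ r ∈ branchNorms A y B x, r < c

variable {A : X →L[𝕜] Y} {y : Y} {Λ : Type u} {B : Set (List Λ)} {x : List Λ → X}
  {ξ : Ordinal.{u}} {σ d : ℝ}

theorem BranchInfLE.mono {d' : ℝ} (h : BranchInfLE A y B x d) (hd : d ≤ d') :
    BranchInfLE A y B x d' := fun c hc => h c (hd.trans_lt hc)

theorem branchNorms_nonneg {r : ℝ} (hr : r ∈ branchNorms A y B x) : 0 ≤ r := by
  obtain ⟨t, -, z, -, rfl⟩ := hr
  exact norm_nonneg _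

theorem IsNullTree.nonempty (h : IsNullTree 𝕜 ξ σ B x) : B.Nonempty := by
  have := h.order.2 0 (Ordinal.opow_pos ξ Ordinal.omega0_pos)
  rwa [treeDeriv_zero] at this

theorem self_mem_branchHull {t : List Λ} (ht : t ≠ []) : x t ∈ branchHull 𝕜 x t := by
  have hlen := List.length_pos_iff.2 ht
  refine ⟨Pi.single (t.length - 1) 1, fun i => ?_, ?_, ?_⟩
  · rw [Pi.single_apply]
    split_ifs <;> norm_num
  · simp [hlen]
  · rw [Finset.sum_eq_single (t.length - 1)]
    · simp [Nat.sub_add_cancel hlen]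
    · intro b _ hb
      simp [hb]
    · intro h
      exact absurd (Finset.mem_range.2 (Nat.sub_lt hlen one_pos)) h

theorem IsNullTree.exists_branchNorms_le (h : IsNullTree 𝕜 ξ σ B x) (A : X →L[𝕜] Y) (y : Y) :
    ∃ r ∈ branchNorms A y B x, r ≤ ‖y‖ + ‖A‖ * σ := by
  obtain ⟨t, ht⟩ := h.nonempty
  refine ⟨_, ⟨t, ht, x t, self_mem_branchHull fun h' => h.isBTree.1 (h' ▸ ht), rfl⟩, ?_⟩
  exact (norm_add_le _ _).trans
    (add_le_add le_rfl (A.le_opNorm_of_le (h.norm_le t ht)))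

theorem IsNullTree.branchNorms_nonempty (h : IsNullTree 𝕜 ξ σ B x) (A : X →L[𝕜] Y) (y : Y) :
    (branchNorms A y B x).Nonempty := by
  obtain ⟨r, hr, -⟩ := h.exists_branchNorms_le A y
  exact ⟨r, hr⟩

theorem sInf_branchNorms_le_iff (h : IsNullTree 𝕜 ξ σ B x) :
    sInf (branchNorms A y B x) ≤ d ↔ BranchInfLE A y B x d := by
  have hb : BddBelow (branchNorms A y B x) := ⟨0, fun _ => branchNorms_nonneg⟩
  refine ⟨fun hle c hc => (csInf_lt_iff hb (h.branchNorms_nonempty A y)).1 (hle.trans_lt hc),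
    fun hle => le_of_forall_gt_imp_ge_of_dense fun c hc => ?_⟩
  obtain ⟨r, hr, hrc⟩ := hle c hc
  exact (csInf_le hb hr).trans hrc.le

theorem sInf_branchNorms_sub_one_le_iff (h : IsNullTree 𝕜 ξ σ B x) :
    sInf ((fun r => r - 1) '' branchNorms A y B x) ≤ d ↔ BranchInfLE A y B x (1 + d) := by
  have hb : BddBelow ((fun r : ℝ => r - 1) '' branchNorms A y B x) := by
    refine ⟨-1, ?_⟩
    rintro _ ⟨r, hr, rfl⟩
    have := branchNorms_nonneg hr
    simp only
    linarith
  constructor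
  · intro hle c hc
    obtain ⟨_, ⟨r, hr, rfl⟩, hrc⟩ := (csInf_lt_iff hb ((h.branchNorms_nonempty A y).image _)).1
      (hle.trans_lt (lt_sub_iff_add_lt'.2 hc))
    exact ⟨r, hr, by simpa using hrc⟩
  · intro hle
    refine le_of_forall_gt_imp_ge_of_dense fun c hc => ?_
    obtain ⟨r, hr, hrc⟩ := hle (1 + c) (by linarith)
    exact (csInf_le hb ⟨r, hr, rfl⟩).trans (by simp only; linarith)

theorem sInf_branchNorms_rpow_le_iff (h : IsNullTree 𝕜 ξ σ B x) {p : ℝ} (hp : 0 < p)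
    (hd : 0 ≤ d) :
    sInf ((fun r => r ^ p) '' branchNorms A y B x) ≤ d ↔ BranchInfLE A y B x (d ^ p⁻¹) := by
  have hb : BddBelow ((fun r : ℝ => r ^ p) '' branchNorms A y B x) := by
    refine ⟨0, ?_⟩
    rintro _ ⟨r, hr, rfl⟩
    exact Real.rpow_nonneg (branchNorms_nonneg hr) p
  constructor
  · intro hle c hc
    have hc0 : 0 ≤ c := (Real.rpow_nonneg hd _).trans hc.le
    obtain ⟨_, ⟨r, hr, rfl⟩, hrc⟩ := (csInf_lt_iff hb ((h.branchNorms_nonempty A y).image _)).1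
      (hle.trans_lt ((Real.rpow_inv_lt_iff_of_pos hd hc0 hp).1 hc))
    exact ⟨r, hr, (Real.rpow_lt_rpow_iff (branchNorms_nonneg hr) hc0 hp).1 hrc⟩
  · intro hle
    refine le_of_forall_gt_imp_ge_of_dense fun c hc => ?_
    have hc0 : 0 ≤ c := hd.trans hc.le
    obtain ⟨r, hr, hrc⟩ := hle (c ^ p⁻¹) (Real.rpow_lt_rpow hd hc (inv_pos.2 hp))
    refine (csInf_le hb ⟨r, hr, rfl⟩).trans ?_
    exact ((Real.lt_rpow_inv_iff_of_pos (branchNorms_nonneg hr) hc0 hp).1 hrc).le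

/-! #### Transport of null trees by operators -/

theorem IsNullTree.map (h : IsNullTree 𝕜 ξ σ B x) (J : X →L[𝕜] X') {c : ℝ} (hc : 0 ≤ c)
    (hJ : ∀ v, ‖J v‖ ≤ c * ‖v‖) : IsNullTree 𝕜 ξ (c * σ) B (fun t => J (x t)) := by
  refine ⟨h.isBTree, h.order, fun ζ t ht => ?_, fun t ht =>
    (hJ _).trans (mul_le_mul_of_nonneg_left (h.norm_le t ht) hc)⟩
  have h0 := mem_closure_iff_frequently.1 (h.weaklyNull ζ t ht)
  have hlim : Tendsto (WeakSpace.map J) (𝓝 0) (𝓝 0) := by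
    have := (WeakSpace.map J).continuous.tendsto 0
    rwa [map_zero] at this
  refine mem_closure_iff_frequently.2 (hlim.frequently (h0.mono ?_))
  rintro _ ⟨_, ⟨s, hs, rfl⟩, rfl⟩
  exact ⟨_, ⟨s, hs, rfl⟩, rfl⟩

/-- Serves both the coordinate inclusions, with `c = 1`, and the normalisation of `y`, with `c =
‖y‖⁻¹`. -/
theorem BranchInfLE.of_map {A' : X' →L[𝕜] Y'} {JX : X →L[𝕜] X'} {JY : Y →L[𝕜] Y'} {c : ℝ}
    (hc : 0 < c) (hJ : ∀ v, ‖JY v‖ = c * ‖v‖) (hA : ∀ v, A' (JX v) = JY (A v))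
    (h : BranchInfLE A' (JY y) B (fun t => JX (x t)) (c * d)) : BranchInfLE A y B x d := by
  intro e he
  obtain ⟨_, ⟨t, ht, z, ⟨w, hw, hw1, rfl⟩, rfl⟩, hlt⟩ := h (c * e) (mul_lt_mul_of_pos_left he hc)
  refine ⟨_, ⟨t, ht, _, ⟨w, hw, hw1, rfl⟩, rfl⟩, ?_⟩
  simp only [← map_smul, ← map_sum, hA, ← map_add, hJ] at hlt
  exact lt_of_mul_lt_mul_left hlt hc.le

/-! #### Reformulation of the moduli -/

theorem branchInfLE_of_rhoMod_le (h : rhoMod ξ A σ ≤ (d : EReal)) (hy : ‖y‖ ≤ 1)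
    (hx : IsNullTree 𝕜 ξ σ B x) : BranchInfLE A y B x (1 + d) := by
  simp only [rhoMod, iSup_le_iff, EReal.coe_le_coe_iff] at h
  exact (sInf_branchNorms_sub_one_le_iff hx).1 (h y hy Λ B x hx)

theorem rhoMod_le (h : ∀ (y : Y), ‖y‖ ≤ 1 → ∀ (Λ : Type u) (B : Set (List Λ)) (x : List Λ → X),
    IsNullTree 𝕜 ξ σ B x → BranchInfLE A y B x (1 + d)) : rhoMod ξ A σ ≤ (d : EReal) := by
  simp only [rhoMod, iSup_le_iff, EReal.coe_le_coe_iff]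
  exact fun y hy Λ B x hx => (sInf_branchNorms_sub_one_le_iff hx).2 (h y hy Λ B x hx)

theorem branchInfLE_of_tConst_lt {p C : ℝ} (hp : 0 < p) (h : tConst ξ p A < ENNReal.ofReal C)
    (hσ : 0 < σ) (hx : IsNullTree 𝕜 ξ σ B x) :
    BranchInfLE A y B x ((‖y‖ ^ p + C * σ ^ p) ^ p⁻¹) := by
  obtain ⟨_, ⟨C₁, ⟨hC₁, hadm⟩, rfl⟩, hlt⟩ := sInf_lt_iff.1 h
  have hσp : 0 ≤ σ ^ p := Real.rpow_nonneg hσ.le p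
  have hnn : 0 ≤ ‖y‖ ^ p + C₁ * σ ^ p := by positivity
  refine ((sInf_branchNorms_rpow_le_iff hx hp hnn).1 (hadm y σ hσ Λ B x hx)).mono ?_
  have := (ENNReal.ofReal_lt_ofReal_iff_of_nonneg hC₁.le).1 hlt
  exact Real.rpow_le_rpow hnn (by gcongr) (inv_nonneg.2 hp.le)

theorem tConst_le {p C : ℝ} (hp : 0 < p) (hC : 0 < C)
    (h : ∀ (y : Y) (σ : ℝ), 0 < σ → ∀ (Λ : Type u) (B : Set (List Λ)) (x : List Λ → X),
      IsNullTree 𝕜 ξ σ B x → BranchInfLE A y B x ((‖y‖ ^ p + C * σ ^ p) ^ p⁻¹)) :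
    tConst ξ p A ≤ ENNReal.ofReal C :=
  sInf_le ⟨C, ⟨hC, fun y σ hσ Λ B x hx =>
    (sInf_branchNorms_rpow_le_iff hx hp (by positivity)).2 (h y σ hσ Λ B x hx)⟩, rfl⟩

theorem branchInfLE_of_tConstTop_lt {C : ℝ} (h : tConstTop ξ A < ENNReal.ofReal C)
    (hσ : 0 < σ) (hx : IsNullTree 𝕜 ξ σ B x) : BranchInfLE A y B x (max ‖y‖ (C * σ)) := by
  obtain ⟨_, ⟨C₁, ⟨hC₁, hadm⟩, rfl⟩, hlt⟩ := sInf_lt_iff.1 h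
  refine ((sInf_branchNorms_le_iff hx).1 (hadm y σ hσ Λ B x hx)).mono ?_
  have := (ENNReal.ofReal_lt_ofReal_iff_of_nonneg hC₁.le).1 hlt
  gcongr

theorem tConstTop_le {C : ℝ} (hC : 0 < C)
    (h : ∀ (y : Y) (σ : ℝ), 0 < σ → ∀ (Λ : Type u) (B : Set (List Λ)) (x : List Λ → X),
      IsNullTree 𝕜 ξ σ B x → BranchInfLE A y B x (max ‖y‖ (C * σ))) :
    tConstTop ξ A ≤ ENNReal.ofReal C :=
  sInf_le ⟨C, ⟨hC, fun y σ hσ Λ B x hx =>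
    (sInf_branchNorms_le_iff hx).2 (h y σ hσ Λ B x hx)⟩, rfl⟩

/-! #### Comparison of the moduli -/

theorem rhoMod_le_of_isometry {A' : X' →L[𝕜] Y'} (JX : X →L[𝕜] X') (JY : Y →L[𝕜] Y')
    (hX : ∀ v, ‖JX v‖ = ‖v‖) (hY : ∀ v, ‖JY v‖ = ‖v‖) (hA : ∀ v, A' (JX v) = JY (A v))
    (h : rhoMod ξ A' σ ≤ (d : EReal)) : rhoMod ξ A σ ≤ (d : EReal) := by
  refine rhoMod_le fun y hy Λ B x hx => BranchInfLE.of_map one_pos (by simpa using hY) hA ?_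
  rw [one_mul]
  refine branchInfLE_of_rhoMod_le h (by rwa [hY]) ?_
  have := hx.map JX zero_le_one (fun v => by rw [hX, one_mul])
  rwa [one_mul] at this

theorem rhoMod_le_of_tConst_lt {p C : ℝ} (hp : 1 ≤ p) (h : tConst ξ p A < ENNReal.ofReal C)
    (hσ : 0 < σ) : rhoMod ξ A σ ≤ ((C * σ ^ p : ℝ) : EReal) := by
  have hC : 0 < C := ENNReal.ofReal_pos.1 (bot_le.trans_lt h)
  refine rhoMod_le fun y hy Λ B x hx =>
    (branchInfLE_of_tConst_lt (zero_lt_one.trans_le hp) h hσ hx).mono ?_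
  have hσp : 0 ≤ C * σ ^ p := by positivity
  calc (‖y‖ ^ p + C * σ ^ p) ^ p⁻¹ ≤ (1 + C * σ ^ p) ^ p⁻¹ := by
        have : ‖y‖ ^ p ≤ 1 := Real.rpow_le_one (norm_nonneg y) hy (by linarith)
        gcongr
    _ ≤ (1 + C * σ ^ p) ^ (1 : ℝ) :=
        Real.rpow_le_rpow_of_exponent_le (by linarith) (inv_le_one_of_one_le₀ hp)
    _ = _ := Real.rpow_one _

/-- Convexity of the `p`-th power between `1` and `1 + D`. -/
theorem one_add_mul_rpow_le {p D v : ℝ} (hp : 1 ≤ p) (hD : 0 ≤ D) (hv : 0 ≤ v) (hv1 : v ≤ 1) :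
    (1 + D * v) ^ p ≤ 1 + (1 + D) ^ p * v := by
  have h := (convexOn_rpow hp).2 (x := 1) (y := 1 + D) (by simp) (by simp; linarith)
    (sub_nonneg.2 hv1) hv (by ring)
  simp only [smul_eq_mul, Real.one_rpow, mul_one] at h
  have h2 : 1 - v + v * (1 + D) = 1 + D * v := by ring
  rw [h2] at h
  linarith

theorem tConst_le_of_rhoMod_le {p D a : ℝ} (hp : 1 ≤ p) (hD : 0 ≤ D) (ha : ‖A‖ ≤ a)
    (h : ∀ σ ∈ Ioo (0 : ℝ) 1, rhoMod ξ A σ ≤ ((D * σ ^ p : ℝ) : EReal)) :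
    tConst ξ p A ≤ ENNReal.ofReal ((1 + D) ^ p + (1 + a) ^ p) := by
  have hp0 : 0 < p := zero_lt_one.trans_le hp
  have ha0 : 0 ≤ a := (norm_nonneg A).trans ha
  have h1D : 0 < (1 + D) ^ p := by positivity
  have h1a : 0 < (1 + a) ^ p := by positivity
  refine tConst_le hp0 (by positivity) fun y σ hσ Λ B x hx => ?_
  have hσp : 0 < σ ^ p := by positivity
  have hyp : 0 ≤ ‖y‖ ^ p := by positivity
  -- For `‖y‖ ≤ σ` the triangle inequality gives `(1 + a) σ`. Otherwise divide by `‖y‖`: the scale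
  -- `σ / ‖y‖` is below `1` and the modulus applies. The two terms of the constant cover these
  -- cases.
  rcases le_or_gt ‖y‖ σ with hy | hy
  · intro c hc
    obtain ⟨r, hr, hle⟩ := hx.exists_branchNorms_le A y
    refine ⟨r, hr, lt_of_le_of_lt ?_ hc⟩
    rw [Real.le_rpow_inv_iff_of_pos (branchNorms_nonneg hr) (by positivity) hp0]
    calc r ^ p ≤ ((1 + a) * σ) ^ p := by
          refine Real.rpow_le_rpow (branchNorms_nonneg hr) (hle.trans ?_) hp0.le
          rw [add_mul, one_mul]
          gcongr
      _ = (1 + a) ^ p * σ ^ p := Real.mul_rpow (by positivity) hσ.le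
      _ ≤ _ := by nlinarith
  · have hy0 : 0 < ‖y‖ := hσ.trans hy
    have hs : ‖y‖⁻¹ * σ ∈ Ioo (0 : ℝ) 1 :=
      ⟨by positivity, by rwa [inv_mul_lt_iff₀ hy0, mul_one]⟩
    set s := ‖y‖⁻¹ * σ with hs'
    have hinv : (0 : ℝ) < ‖y‖⁻¹ := inv_pos.2 hy0
    have hnorm : ∀ {Z : Type u} [NormedAddCommGroup Z] [NormedSpace 𝕜 Z] (v : Z),
        ‖((((‖y‖⁻¹ : ℝ) : 𝕜) • ContinuousLinearMap.id 𝕜 Z) v)‖ = ‖y‖⁻¹ * ‖v‖ := by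
      intro Z _ _ v
      rw [_root_.smul_apply, ContinuousLinearMap.id_apply, norm_smul, RCLike.norm_ofReal,
        abs_of_pos hinv]
    have hx' := hx.map (((‖y‖⁻¹ : ℝ) : 𝕜) • ContinuousLinearMap.id 𝕜 X) hinv.le
      (fun v => (hnorm v).le)
    have hmain := branchInfLE_of_rhoMod_le (h s hs)
      (y := (((‖y‖⁻¹ : ℝ) : 𝕜) • ContinuousLinearMap.id 𝕜 Y) y)
      (by rw [hnorm, inv_mul_cancel₀ hy0.ne']) hx'
    refine BranchInfLE.of_map hinv hnorm (fun v => by simp) (hmain.mono ?_)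
    have hsp1 : s ^ p ≤ 1 := Real.rpow_le_one hs.1.le hs.2.le hp0.le
    have hsp0 : 0 ≤ s ^ p := Real.rpow_nonneg hs.1.le p
    rw [le_inv_mul_iff₀ hy0, Real.le_rpow_inv_iff_of_pos (by positivity) (by positivity) hp0,
      Real.mul_rpow hy0.le (by positivity)]
    have hσs : σ = ‖y‖ * s := by rw [hs', mul_inv_cancel_left₀ hy0.ne']
    rw [hσs, Real.mul_rpow hy0.le hs.1.le]
    have h1 := one_add_mul_rpow_le hp hD hsp0 hsp1
    have h2 := mul_le_mul_of_nonneg_left h1 hyp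
    have h3 : 0 ≤ (1 + a) ^ p * (‖y‖ ^ p * s ^ p) := by positivity
    nlinarith

end Moduli

/-! ### Real inequalities -/

/-- Minkowski's inequality with exponent `Q / p`, applied to the `p`-th powers; this is where `p ≤
q` enters. -/
theorem minkowski_rpow_le {O : Type*} [Fintype O] {p Q C : ℝ} (hp : 0 < p) (hpQ : p ≤ Q)
    (hC : 0 ≤ C) {a b r : O → ℝ} (ha : ∀ o, 0 ≤ a o) (hb : ∀ o, 0 ≤ b o) (hr : ∀ o, 0 ≤ r o)
    (h : ∀ o, r o ^ p ≤ a o ^ p + C * b o ^ p) :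
    (∑ o, r o ^ Q) ^ Q⁻¹ ≤
      (((∑ o, a o ^ Q) ^ Q⁻¹) ^ p + C * ((∑ o, b o ^ Q) ^ Q⁻¹) ^ p) ^ p⁻¹ := by
  have hQ : 0 < Q := hp.trans_le hpQ
  have hs1 : 1 ≤ Q / p := (one_le_div hp).2 hpQ
  have hs0 : 0 < Q / p := zero_lt_one.trans_le hs1
  have hpow : ∀ {x : ℝ}, 0 ≤ x → (x ^ p) ^ (Q / p) = x ^ Q := fun hx => by
    rw [← Real.rpow_mul hx, mul_div_cancel₀ _ hp.ne']
  have hroot : ∀ {x : ℝ}, 0 ≤ x → x ^ (1 / (Q / p)) = (x ^ Q⁻¹) ^ p := fun hx => by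
    rw [← Real.rpow_mul hx, one_div_div, div_eq_inv_mul]
  have hsum : ∀ {f : O → ℝ}, (∀ o, 0 ≤ f o) → 0 ≤ ∑ o, f o ^ Q := fun hf =>
    Finset.sum_nonneg fun o _ => Real.rpow_nonneg (hf o) Q
  have hmink := Real.Lp_add_le_of_nonneg Finset.univ (f := fun o => a o ^ p)
    (g := fun o => C * b o ^ p) hs1 (fun o _ => Real.rpow_nonneg (ha o) p)
    (fun o _ => mul_nonneg hC (Real.rpow_nonneg (hb o) p))
  have hle : ∑ o, r o ^ Q ≤ ∑ o, (a o ^ p + C * b o ^ p) ^ (Q / p) :=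
    Finset.sum_le_sum fun o _ => by
      rw [← hpow (hr o)]
      exact Real.rpow_le_rpow (Real.rpow_nonneg (hr o) p) (h o) hs0.le
  have h1 : ∑ o, (a o ^ p) ^ (Q / p) = ∑ o, a o ^ Q :=
    Finset.sum_congr rfl fun o _ => hpow (ha o)
  have h2 : ∑ o, (C * b o ^ p) ^ (Q / p) = C ^ (Q / p) * ∑ o, b o ^ Q := by
    rw [Finset.mul_sum]
    refine Finset.sum_congr rfl fun o _ => ?_
    rw [Real.mul_rpow hC (Real.rpow_nonneg (hb o) p), hpow (hb o)]
  rw [h1, h2, Real.mul_rpow (Real.rpow_nonneg hC _) (hsum hb), ← Real.rpow_mul hC,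
    mul_one_div_cancel hs0.ne', Real.rpow_one, hroot (hsum ha), hroot (hsum hb)] at hmink
  rw [Real.le_rpow_inv_iff_of_pos (Real.rpow_nonneg (hsum hr) _)
    (add_nonneg (Real.rpow_nonneg (Real.rpow_nonneg (hsum ha) _) _)
      (mul_nonneg hC (Real.rpow_nonneg (Real.rpow_nonneg (hsum hb) _) _))) hp,
    ← hroot (hsum hr)]
  exact (Real.rpow_le_rpow (hsum hr) hle (by positivity)).trans hmink

theorem sum_add_const_rpow_le {O : Type*} [Fintype O] [Nonempty O] {Q η : ℝ} (hQ : 1 ≤ Q)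
    (hη : 0 ≤ η) {a b : O → ℝ} (ha : ∀ o, 0 ≤ a o) (hb : ∀ o, 0 ≤ b o)
    (h : ∀ o, b o ≤ a o + η) :
    (∑ o, b o ^ Q) ^ Q⁻¹ ≤ (∑ o, a o ^ Q) ^ Q⁻¹ + η * Fintype.card O := by
  have hQ0 : 0 < Q := zero_lt_one.trans_le hQ
  have hmink := Real.Lp_add_le_of_nonneg Finset.univ (f := a) (g := fun _ => η) hQ
    (fun o _ => ha o) (fun _ _ => hη)
  rw [one_div] at hmink
  refine (Real.rpow_le_rpow (Finset.sum_nonneg fun o _ => Real.rpow_nonneg (hb o) Q)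
    (Finset.sum_le_sum fun o _ => Real.rpow_le_rpow (hb o) (h o) hQ0.le)
    (inv_nonneg.2 hQ0.le)).trans (hmink.trans (add_le_add le_rfl ?_))
  have hcard : (1 : ℝ) ≤ Fintype.card O := by exact_mod_cast Fintype.card_pos
  rw [Finset.sum_const, Finset.card_univ, nsmul_eq_mul,
    Real.mul_rpow (by positivity) (Real.rpow_nonneg hη _), Real.rpow_rpow_inv hη hQ0.ne', mul_comm]
  refine mul_le_mul_of_nonneg_left ?_ hη
  calc (Fintype.card O : ℝ) ^ Q⁻¹ ≤ (Fintype.card O : ℝ) ^ (1 : ℝ) :=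
        Real.rpow_le_rpow_of_exponent_le hcard (inv_le_one_of_one_le₀ hQ)
    _ = _ := Real.rpow_one _

theorem norm_convexCombination_le {𝕜 E : Type*} [RCLike 𝕜] [NormedAddCommGroup E]
    [NormedSpace 𝕜 E] {n : ℕ} {w : ℕ → ℝ} (hw : ∀ i, 0 ≤ w i)
    (hw1 : ∑ i ∈ Finset.range n, w i = 1) {v : ℕ → E} {τ : ℝ}
    (h : ∀ i < n, w i ≠ 0 → ‖v i‖ ≤ τ) : ‖∑ i ∈ Finset.range n, (w i : 𝕜) • v i‖ ≤ τ := by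
  calc ‖∑ i ∈ Finset.range n, (w i : 𝕜) • v i‖ ≤ ∑ i ∈ Finset.range n, w i * τ := by
        refine norm_sum_le_of_le _ fun i hi => ?_
        rw [norm_smul, RCLike.norm_ofReal, abs_of_nonneg (hw i)]
        by_cases hi0 : w i = 0
        · simp [hi0]
        · exact mul_le_mul_of_nonneg_left (h i (Finset.mem_range.1 hi) hi0) (hw i)
    _ = τ := by rw [← Finset.sum_mul, hw1, one_mul]

/-! ### Direct sums -/

section Sums

variable {𝕜 : Type v} [RCLike 𝕜] {ι : Type u} {X Y : ι → Type u}
  [∀ i, NormedAddCommGroup (X i)] [∀ i, NormedSpace 𝕜 (X i)]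
  [∀ i, NormedAddCommGroup (Y i)] [∀ i, NormedSpace 𝕜 (Y i)]

theorem exists_branchNorms_lt_of_tConst_lt {X Y : Type u} [NormedAddCommGroup X]
    [NormedSpace 𝕜 X] [NormedAddCommGroup Y] [NormedSpace 𝕜 Y] {A : X →L[𝕜] Y} {y : Y}
    {Λ : Type u} {B : Set (List Λ)} {x : List Λ → X} {ξ : Ordinal.{u}} {σ p C : ℝ} (hp : 0 < p)
    (h : tConst ξ p A < ENNReal.ofReal C) (hσ : 0 < σ) (hx : IsNullTree 𝕜 ξ σ B x) :
    ∃ r ∈ branchNorms A y B x, r < (‖y‖ ^ p + C * σ ^ p) ^ p⁻¹ := by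
  obtain ⟨C₁, hC₁, hlt, hlt'⟩ := ENNReal.lt_iff_exists_real_btwn.1 h
  have hCC := (ENNReal.ofReal_lt_ofReal_iff_of_nonneg hC₁).1 hlt'
  have hσp : 0 < σ ^ p := Real.rpow_pos_of_pos hσ p
  exact branchInfLE_of_tConst_lt hp hlt hσ hx _ (Real.rpow_lt_rpow (by positivity)
    (by gcongr) (inv_pos.2 hp))

/-! ### The upper estimate for `ℓ_q`-sums -/

section Lp

variable {q : ℝ≥0∞} [Fact (1 ≤ q)]

@[simp]
theorem lpSumMap_apply (A : ∀ i, X i →L[𝕜] Y i) (hA : BddAbove (range fun i => ‖A i‖))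
    (f : lp X q) (i : ι) : lpSumMap q A hA f i = A i (f i) := rfl

theorem norm_lpSumMap_le [Nonempty ι] (A : ∀ i, X i →L[𝕜] Y i)
    (hA : BddAbove (range fun i => ‖A i‖)) {a : ℝ} (ha : ∀ i, ‖A i‖ ≤ a) :
    ‖lpSumMap q A hA‖ ≤ a :=
  (lp.norm_mapCLM_le _ _ _ _).trans (ciSup_le ha)

theorem lpSumMap_single [DecidableEq ι] (A : ∀ i, X i →L[𝕜] Y i)
    (hA : BddAbove (range fun i => ‖A i‖)) (i : ι) (v : X i) :
    lpSumMap q A hA (lp.single q i v) = lp.single q i (A i v) := by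
  ext j
  rw [lpSumMap_apply]
  by_cases h : j = i
  · subst h
    simp
  · rw [lp.single_apply_ne _ _ _ h, lp.single_apply_ne _ _ _ h, map_zero]

variable (𝕜 X q) in
/-- The projection of an `ℓ_q`-sum that deletes the coordinates in `s`. -/
def lpTail [DecidableEq ι] (s : Finset ι) : lp X q →L[𝕜] lp X q :=
  ContinuousLinearMap.id 𝕜 _ -
    ∑ i ∈ s, (lp.singleContinuousLinearMap 𝕜 X q i).comp (lp.evalCLM 𝕜 X q i)

theorem lpTail_apply [DecidableEq ι] (s : Finset ι) (f : lp X q) :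
    lpTail 𝕜 X q s f = f - ∑ i ∈ s, lp.single q i (f i) := by
  simp only [lpTail, _root_.sub_apply, ContinuousLinearMap.id_apply, _root_.sum_apply,
    ContinuousLinearMap.comp_apply, lp.singleContinuousLinearMap_apply]
  rfl

theorem lpSumMap_lpTail [DecidableEq ι] (A : ∀ i, X i →L[𝕜] Y i)
    (hA : BddAbove (range fun i => ‖A i‖)) (s : Finset ι) (f : lp X q) :
    lpTail 𝕜 Y q s (lpSumMap q A hA f) = lpSumMap q A hA (lpTail 𝕜 X q s f) := by
  rw [lpTail_apply, lpTail_apply, map_sub, map_sum]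
  simp only [lpSumMap_single, lpSumMap_apply]

/-- The norms of the coordinates in `s` and of the remaining part of `f`. -/
def lpPartNorm (𝕜 : Type v) [RCLike 𝕜] {X : ι → Type u} [∀ i, NormedAddCommGroup (X i)]
    [∀ i, NormedSpace 𝕜 (X i)] [DecidableEq ι] (s : Finset ι) (f : lp X q) (o : Option s) : ℝ :=
  o.elim ‖lpTail 𝕜 X q s f‖ fun i => ‖f i‖

theorem lpPartNorm_nonneg [DecidableEq ι] (s : Finset ι) (f : lp X q) (o : Option s) :
    0 ≤ lpPartNorm 𝕜 s f o := by
  cases o <;> exact norm_nonneg _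

theorem sum_lpPartNorm_rpow [DecidableEq ι] (hq : 0 < q.toReal) (s : Finset ι) (f : lp X q) :
    (∑ o, lpPartNorm 𝕜 s f o ^ q.toReal) ^ (q.toReal)⁻¹ = ‖f‖ := by
  have h : ∑ o, lpPartNorm 𝕜 s f o ^ q.toReal = ‖f‖ ^ q.toReal := by
    rw [Fintype.sum_option]
    simp only [lpPartNorm, Option.elim]
    rw [lpTail_apply, lp.norm_compl_sum_single hq,
      Finset.sum_coe_sort s fun i => ‖f i‖ ^ q.toReal, sub_add_cancel]
  rw [h, Real.rpow_rpow_inv (norm_nonneg _) hq.ne']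

theorem lpPartNorm_le_norm [DecidableEq ι] (hq : 0 < q.toReal) (s : Finset ι) (f : lp X q)
    (o : Option s) : lpPartNorm 𝕜 s f o ≤ ‖f‖ := by
  rw [← sum_lpPartNorm_rpow (𝕜 := 𝕜) hq s f, Real.le_rpow_inv_iff_of_pos
    (lpPartNorm_nonneg s f o)
    (Finset.sum_nonneg fun o _ => Real.rpow_nonneg (lpPartNorm_nonneg s f o) _) hq]
  exact Finset.single_le_sum (f := fun o => lpPartNorm 𝕜 s f o ^ q.toReal)
    (fun o _ => Real.rpow_nonneg (lpPartNorm_nonneg s f o) _) (Finset.mem_univ o)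

/-- Vectors are coloured by the norms of their parts, rounded to multiples of `η`; all coordinates
outside `s` count as one part. There `y` vanishes and the norm bound on the operators suffices; on
`s` the simultaneous combination is used. -/
theorem IsNullTree.exists_branchNorms_lpSumMap_le [Nonempty ι] [DecidableEq ι]
    (A : ∀ i, X i →L[𝕜] Y i)
    (hA : BddAbove (range fun i => ‖A i‖)) {ξ : Ordinal.{u}} {p C : ℝ} (hp : 0 < p)
    (hq1 : 1 ≤ q.toReal) (hpq : p ≤ q.toReal) (hC : 0 < C) (hAC : ∀ i, ‖A i‖ ^ p ≤ C)
    (hT : ∀ i, tConst ξ p (A i) < ENNReal.ofReal C) {σ η : ℝ} (hη : 0 < η)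
    {Λ : Type u} {B : Set (List Λ)} {x : List Λ → lp X q} (hx : IsNullTree 𝕜 ξ σ B x)
    (s : Finset ι) (y : lp Y q) (hy : lpTail 𝕜 Y q s y = 0) :
    ∃ r ∈ branchNorms (lpSumMap q A hA) y B x,
      r ≤ (‖y‖ ^ p + C * (σ + η * (s.card + 1)) ^ p) ^ p⁻¹ := by
  have hq : 0 < q.toReal := hp.trans_le hpq
  set N : ℕ := ⌊σ / η⌋₊ with hN
  -- The cap at `N` makes the colours finite in number; it is inactive on the tree, whose vectors
  -- have norm at most `σ`. Below, `τ k o` is the upper end of the cell.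
  let c : lp X q → Option s → Fin (N + 1) := fun e o =>
    ⟨min ⌊lpPartNorm 𝕜 s e o / η⌋₊ N, Nat.lt_succ_of_le (min_le_right _ _)⟩
  let τ : (Option s → Fin (N + 1)) → Option s → ℝ := fun k o => η * ((k o : ℕ) + 1)
  have hτ0 : ∀ k o, 0 < τ k o := fun k o => by positivity
  have hτle : ∀ e o, τ (c e) o ≤ lpPartNorm 𝕜 s e o + η := by
    intro e o
    have h1 : (((c e o : ℕ)) : ℝ) ≤ lpPartNorm 𝕜 s e o / η :=
      (Nat.cast_le.2 (min_le_left _ _)).trans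
        (Nat.floor_le (div_nonneg (lpPartNorm_nonneg s e o) hη.le))
    have := (le_div_iff₀' hη).1 h1
    simp only [τ]
    linarith
  have hτge : ∀ t ∈ B, ∀ o, lpPartNorm 𝕜 s (x t) o ≤ τ (c (x t)) o := by
    intro t ht o
    have hfl : ⌊lpPartNorm 𝕜 s (x t) o / η⌋₊ ≤ N := Nat.floor_le_floor
      (div_le_div_of_nonneg_right ((lpPartNorm_le_norm hq s _ o).trans (hx.norm_le t ht)) hη.le)
    have := (Nat.lt_floor_add_one (lpPartNorm 𝕜 s (x t) o / η)).le
    rw [div_le_iff₀' hη] at this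
    simpa only [τ, c, min_eq_left hfl] using this
  obtain ⟨k, t, ht, w, hw, hw1, hwc, hlt⟩ := hx.exists_simultaneous (J := s)
    (fun j => lp.evalCLM 𝕜 X q j.1) (fun j => A j) (fun j => y j) c
    (τ := fun k j => τ k (some j)) (R := fun k j => (‖y j‖ ^ p + C * τ k (some j) ^ p) ^ p⁻¹)
    (fun k j => by have := hτ0 k (some j); positivity)
    (fun t ht j => hτge t ht (some j))
    (fun k j Λ' B' x' hx' => exists_branchNorms_lt_of_tConst_lt hp (hT j) (hτ0 k _) hx')
  set z : lp X q := ∑ i ∈ Finset.range t.length, (w i : 𝕜) • x (t.take (i + 1)) with hz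
  refine ⟨_, ⟨t, ht, z, ⟨w, hw, hw1, rfl⟩, rfl⟩, ?_⟩
  set v : lp Y q := y + lpSumMap q A hA z with hv
  have htail : lpPartNorm 𝕜 s v none ≤ C ^ p⁻¹ * τ k none := by
    have h1 : lpTail 𝕜 Y q s v = lpSumMap q A hA (lpTail 𝕜 X q s z) := by
      rw [hv, map_add, hy, zero_add, lpSumMap_lpTail]
    have h2 : ‖lpTail 𝕜 X q s z‖ ≤ τ k none := by
      rw [hz, map_sum]
      simp only [map_smul]
      refine norm_convexCombination_le hw hw1 fun i hi hi0 => ?_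
      rw [← hwc i hi hi0]
      exact hτge _ (hx.take_mem ht hi) none
    have h3 : ‖lpSumMap q A hA‖ ≤ C ^ p⁻¹ := norm_lpSumMap_le A hA fun i =>
      (Real.le_rpow_inv_iff_of_pos (norm_nonneg _) hC.le hp).2 (hAC i)
    change ‖lpTail 𝕜 Y q s v‖ ≤ _
    rw [h1]
    exact ContinuousLinearMap.le_of_opNorm_le_of_le _ h3 h2
  have hpart : ∀ o, lpPartNorm 𝕜 s v o ^ p ≤ lpPartNorm 𝕜 s y o ^ p + C * τ k o ^ p := by
    rintro (_ | j)
    · have h1 := Real.rpow_le_rpow (lpPartNorm_nonneg s v none) htail hp.le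
      rw [Real.mul_rpow (Real.rpow_nonneg hC.le _) (hτ0 k none).le, Real.rpow_inv_rpow hC.le hp.ne'] at h1
      exact h1.trans (le_add_of_nonneg_left (Real.rpow_nonneg (lpPartNorm_nonneg s y _) p))
    · have h1 := hτ0 k (some j)
      exact (Real.le_rpow_inv_iff_of_pos (norm_nonneg _) (add_nonneg (Real.rpow_nonneg (norm_nonneg _) p) (mul_nonneg hC.le (Real.rpow_nonneg h1.le p))) hp).1 (hlt j).le
  -- A node of positive weight has colour `k`, so the bounds `τ k` exceed the part norms of an
  -- actual vector of norm at most `σ` by at most `η` each. This controls their `ℓ_q`-norm.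
  obtain ⟨i, hi, hi0⟩ : ∃ i ∈ Finset.range t.length, w i ≠ 0 :=
    Finset.exists_ne_zero_of_sum_ne_zero (by rw [hw1]; exact one_ne_zero)
  have hi' := Finset.mem_range.1 hi
  set e := x (t.take (i + 1)) with he
  have hke : c e = k := hwc i hi' hi0
  have hsum : (∑ o, τ k o ^ q.toReal) ^ (q.toReal)⁻¹ ≤ σ + η * (s.card + 1) := by
    refine (sum_add_const_rpow_le hq1 hη.le (lpPartNorm_nonneg (𝕜 := 𝕜) s e)
      (fun o => (hτ0 k o).le) (fun o => hke ▸ hτle e o)).trans ?_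
    rw [sum_lpPartNorm_rpow hq]
    refine add_le_add (hx.norm_le _ (hx.take_mem ht hi')) (le_of_eq ?_)
    simp
  have hmain := minkowski_rpow_le hp hpq hC.le (lpPartNorm_nonneg (𝕜 := 𝕜) s y)
    (fun o => (hτ0 k o).le) (lpPartNorm_nonneg (𝕜 := 𝕜) s v) hpart
  rw [sum_lpPartNorm_rpow hq, sum_lpPartNorm_rpow hq] at hmain
  refine hmain.trans ?_
  have h0 : 0 ≤ (∑ o, τ k o ^ q.toReal) ^ (q.toReal)⁻¹ :=
    Real.rpow_nonneg (Finset.sum_nonneg fun o _ => Real.rpow_nonneg (hτ0 k o).le _) _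
  gcongr

theorem tConst_lpSumMap_le_ofReal [Nonempty ι] (A : ∀ i, X i →L[𝕜] Y i)
    (hA : BddAbove (range fun i => ‖A i‖)) {ξ : Ordinal.{u}} {p C : ℝ} (hp : 0 < p)
    (hq1 : 1 ≤ q.toReal) (hpq : p ≤ q.toReal) (hq : q ≠ ∞) (hAC : ∀ i, ‖A i‖ ^ p ≤ C)
    (hT : ∀ i, tConst ξ p (A i) < ENNReal.ofReal C) :
    tConst ξ p (lpSumMap q A hA) ≤ ENNReal.ofReal C := by
  classical
  have hC : 0 < C := ENNReal.ofReal_pos.1 (bot_le.trans_lt (hT (Classical.arbitrary ι)))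
  refine tConst_le hp hC fun y σ hσ Λ B x hx d hd => ?_
  -- The perturbation `ε` pays for truncating `y` and for the rounding of norms; both vanish in the
  -- limit.
  have hcont : ContinuousAt
      (fun ε : ℝ => ((‖y‖ + ε) ^ p + C * (σ + ε) ^ p) ^ p⁻¹ + ε) 0 := by
    refine ContinuousAt.add (ContinuousAt.rpow_const (ContinuousAt.add
      (ContinuousAt.rpow_const (by fun_prop) (Or.inr hp.le))
      (continuousAt_const.mul (ContinuousAt.rpow_const (by fun_prop) (Or.inr hp.le))))
      (Or.inr (inv_nonneg.2 hp.le))) continuousAt_id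
  have hev : ∀ᶠ ε in 𝓝[>] (0 : ℝ),
      ((‖y‖ + ε) ^ p + C * (σ + ε) ^ p) ^ p⁻¹ + ε < d :=
    nhdsWithin_le_nhds (hcont.eventually_lt continuousAt_const (by simpa using hd))
  obtain ⟨ε, hεd, hε⟩ := (hev.and self_mem_nhdsWithin).exists
  have hε : 0 < ε := hε
  obtain ⟨s, hs⟩ := ((Metric.tendsto_nhds.1 (lp.hasSum_single hq y)) ε hε).exists
  set y' : lp Y q := ∑ i ∈ s, lp.single q i (y i) with hy'
  have hyy : ‖y - y'‖ < ε := by rwa [← dist_eq_norm, dist_comm]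
  have hy0 : lpTail 𝕜 Y q s y' = 0 := by
    rw [lpTail_apply, sub_eq_zero]
    refine Finset.sum_congr rfl fun i hi => ?_
    congr 1
    have hsum : y' i = ∑ j ∈ s, lp.single q j (y j) i :=
      map_sum (lp.evalCLM 𝕜 Y q i) (fun j => lp.single q j (y j)) s
    rw [hsum, Finset.sum_eq_single i]
    · simp
    · intro j _ hj
      exact (lp.single_apply_ne _ _ _ hj.symm)
    · exact fun h => absurd hi h
  have hcard : (0 : ℝ) < s.card + 1 := by positivity
  -- The mesh is chosen after `s`, so that the total rounding error is exactly `ε`.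
  obtain ⟨_, ⟨t, ht, z, hz, rfl⟩, hle⟩ := hx.exists_branchNorms_lpSumMap_le A hA hp hq1 hpq hC hAC
    hT (η := ε / (s.card + 1)) (by positivity) s y' hy0
  rw [div_mul_cancel₀ _ hcard.ne'] at hle
  refine ⟨_, ⟨t, ht, z, hz, rfl⟩, lt_of_le_of_lt ?_ hεd⟩
  have h1 : ‖y'‖ ≤ ‖y‖ + ε := by
    have := norm_sub_norm_le y' y
    rw [norm_sub_rev] at this
    linarith
  have h2 : ‖y + lpSumMap q A hA z‖ ≤ ‖y' + lpSumMap q A hA z‖ + ‖y - y'‖ := by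
    have : y + lpSumMap q A hA z = (y' + lpSumMap q A hA z) + (y - y') := by abel
    rw [this]
    exact norm_add_le _ _
  refine h2.trans (add_le_add (hle.trans ?_) hyy.le)
  gcongr

end Lp

/-! ### Sums in the sense of `c_0` -/

section CZero

/-- With a supremum norm every coordinate may use the same bound `σ`, so a single colour suffices.
Off the finite set where `‖y i‖ ≥ ε`, the bound `‖A i‖ ≤ C` is enough. -/
theorem tConstTop_c0SumMap_le_ofReal [Nonempty ι] (A : ∀ i, X i →L[𝕜] Y i)
    (hA : BddAbove (range fun i => ‖A i‖)) {ξ : Ordinal.{u}} {C : ℝ} (hAC : ∀ i, ‖A i‖ ≤ C)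
    (hT : ∀ i, tConstTop ξ (A i) < ENNReal.ofReal C) :
    tConstTop ξ (c0SumMap A hA) ≤ ENNReal.ofReal C := by
  have hC : 0 < C := ENNReal.ofReal_pos.1 (bot_le.trans_lt (hT (Classical.arbitrary ι)))
  refine tConstTop_le hC fun y σ hσ Λ B x hx d hd => ?_
  obtain ⟨ε, hε, hεd⟩ : ∃ ε > 0, max ‖y‖ (C * σ) + ε < d :=
    ⟨(d - max ‖y‖ (C * σ)) / 2, by linarith, by linarith⟩
  have hm : 0 ≤ max ‖y‖ (C * σ) := (norm_nonneg y).trans (le_max_left _ _)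
  have hy : ∀ᶠ i in cofinite, ‖y.1 i‖ < ε := y.2.eventually_lt_const hε
  set s : Finset ι := (eventually_cofinite.1 hy).toFinset with hs
  have hcoord : ∀ (i : ι) (w : c0Sum 𝕜 Y), ‖w.1 i‖ ≤ ‖w‖ := fun i w =>
    lp.norm_apply_le_norm ENNReal.top_ne_zero w.1 i
  let π : ∀ i : ι, c0Sum 𝕜 X →L[𝕜] X i := fun i =>
    (lp.evalCLM 𝕜 X ∞ i).comp (c0Sum 𝕜 X).subtypeL
  have hπ : ∀ i v, ‖π i v‖ ≤ ‖v‖ := fun i v =>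
    lp.norm_apply_le_norm ENNReal.top_ne_zero v.1 i
  obtain ⟨-, t, ht, w, hw, hw1, -, hlt⟩ := hx.exists_simultaneous (J := s)
    (fun j => π j) (fun j => A j) (fun j => y.1 j) (fun _ => ()) (τ := fun _ _ => σ)
    (R := fun _ _ => max ‖y‖ (C * σ) + ε) (fun _ _ => by positivity)
    (fun t ht j => (hπ j _).trans (hx.norm_le t ht))
    (fun _ j Λ' B' x' hx' => branchInfLE_of_tConstTop_lt (hT j) hσ hx' _
      ((max_le_max_right _ (hcoord j y)).trans_lt (lt_add_of_pos_right _ hε)))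
  set z : c0Sum 𝕜 X := ∑ i ∈ Finset.range t.length, (w i : 𝕜) • x (t.take (i + 1)) with hz
  refine ⟨_, ⟨t, ht, z, ⟨w, hw, hw1, rfl⟩, rfl⟩, lt_of_le_of_lt ?_ hεd⟩
  have hzσ : ‖z‖ ≤ σ := norm_convexCombination_le hw hw1 fun i hi _ =>
    hx.norm_le _ (hx.take_mem ht hi)
  refine lp.norm_le_of_forall_le (f := (y + c0SumMap A hA z).1) (by positivity) fun i => ?_
  have hi : (y + c0SumMap A hA z).1 i = y.1 i + A i (π i z) := rfl
  rw [hi]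
  by_cases his : i ∈ s
  · exact (hlt ⟨i, his⟩).le
  · have hyi : ‖y.1 i‖ < ε := by
      by_contra h
      exact his ((eventually_cofinite.1 hy).mem_toFinset.2 h)
    have hAi : ‖A i (π i z)‖ ≤ C * σ :=
      ContinuousLinearMap.le_of_opNorm_le_of_le _ (hAC i) ((hπ i z).trans hzσ)
    refine (norm_add_le _ _).trans ?_
    rw [add_comm]
    exact add_le_add (hAi.trans (le_max_right _ _)) hyi.le

variable (𝕜 X) in
/-- The inclusion of a coordinate space in a `c_0`-sum. -/
def c0Single [DecidableEq ι] (i : ι) : X i →L[𝕜] c0Sum 𝕜 X :=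
  (lp.singleContinuousLinearMap 𝕜 X ∞ i).codRestrict (c0Sum 𝕜 X) fun v => by
    change Tendsto (fun j => ‖lp.single ∞ i v j‖) cofinite (𝓝 0)
    refine tendsto_const_nhds.congr' ?_
    have : ∀ᶠ j in cofinite, j ≠ i := by simp [eventually_cofinite]
    filter_upwards [this] with j hj
    rw [lp.single_apply_ne _ _ _ hj, norm_zero]

theorem norm_c0Single [DecidableEq ι] (i : ι) (v : X i) : ‖c0Single 𝕜 X i v‖ = ‖v‖ :=
  lp.norm_single (p := ∞) ENNReal.zero_lt_top i v

theorem c0SumMap_c0Single [DecidableEq ι] (A : ∀ i, X i →L[𝕜] Y i)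
    (hA : BddAbove (range fun i => ‖A i‖)) (i : ι) (v : X i) :
    c0SumMap A hA (c0Single 𝕜 X i v) = c0Single 𝕜 Y i (A i v) :=
  Subtype.ext (lpSumMap_single A hA i v)

theorem iSup_tConstTop_lt_top_of_c0SumMap (A : ∀ i, X i →L[𝕜] Y i)
    (hA : BddAbove (range fun i => ‖A i‖)) {ξ : Ordinal.{u}}
    (h : IsAUSPowerTypeTop ξ (c0SumMap A hA)) : (⨆ i, tConstTop ξ (A i)) < ∞ := by
  classical
  obtain ⟨C, hC⟩ := h
  refine lt_of_le_of_lt (iSup_le fun i => ?_) (ENNReal.ofReal_lt_top (r := max C 1))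
  refine tConstTop_le (by positivity) fun y σ hσ Λ B x hx =>
    BranchInfLE.of_map (X' := c0Sum 𝕜 X) (Y' := c0Sum 𝕜 Y) (A' := c0SumMap A hA) (JX := c0Single 𝕜 X i) (JY := c0Single 𝕜 Y i)
      one_pos (fun v => (norm_c0Single (𝕜 := 𝕜) i v).trans (one_mul _).symm) (c0SumMap_c0Single A hA i) ?_
  have hx' := hx.map (c0Single 𝕜 X i) zero_le_one
    (fun v => ((norm_c0Single (𝕜 := 𝕜) i v).trans (one_mul _).symm).le)
  rw [one_mul] at hx' ⊢
  have := (sInf_branchNorms_le_iff hx').1 (hC (c0Single 𝕜 Y i y) σ hσ Λ B _ hx')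
  rw [norm_c0Single (𝕜 := 𝕜)] at this
  refine this.mono ?_
  gcongr
  exact le_max_left _ _

theorem isAUSPowerTypeTop_of_tConstTop_lt_top {X Y : Type u} [NormedAddCommGroup X]
    [NormedSpace 𝕜 X] [NormedAddCommGroup Y] [NormedSpace 𝕜 Y] {A : X →L[𝕜] Y}
    {ξ : Ordinal.{u}} (h : tConstTop ξ A < ∞) : IsAUSPowerTypeTop ξ A := by
  obtain ⟨C, -, hC, -⟩ := ENNReal.lt_iff_exists_real_btwn.1 h
  exact ⟨C, fun y σ hσ Λ B x hx =>
    (sInf_branchNorms_le_iff hx).2 (branchInfLE_of_tConstTop_lt hC hσ hx)⟩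

theorem tConstTop_c0SumMap_le [Nonempty ι] (A : ∀ i, X i →L[𝕜] Y i)
    (hA : BddAbove (range fun i => ‖A i‖)) (ξ : Ordinal.{u}) :
    tConstTop ξ (c0SumMap A hA) ≤ ⨆ i, max (ENNReal.ofReal ‖A i‖) (tConstTop ξ (A i)) := by
  by_contra! hlt
  -- A real number in the gap meets the strict hypotheses of the estimate for every coordinate.
  obtain ⟨C, hC0, hC, hC'⟩ := ENNReal.lt_iff_exists_real_btwn.1 hlt
  have hi := fun i => max_lt_iff.1 ((le_iSup (fun i => max (ENNReal.ofReal ‖A i‖)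
    (tConstTop ξ (A i))) i).trans_lt hC)
  exact (tConstTop_c0SumMap_le_ofReal A hA
    (fun i => (ENNReal.ofReal_le_ofReal_iff hC0).1 (hi i).1.le) fun i => (hi i).2).not_gt hC'

theorem isAUSPowerTypeTop_c0SumMap_iff [Nonempty ι] (A : ∀ i, X i →L[𝕜] Y i)
    (hA : BddAbove (range fun i => ‖A i‖)) (ξ : Ordinal.{u}) :
    IsAUSPowerTypeTop ξ (c0SumMap A hA) ↔ (⨆ i, tConstTop ξ (A i)) < ∞ := by
  refine ⟨iSup_tConstTop_lt_top_of_c0SumMap A hA, fun h =>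
    isAUSPowerTypeTop_of_tConstTop_lt_top ((tConstTop_c0SumMap_le A hA ξ).trans_lt ?_)⟩
  rw [iSup_sup_eq, sup_lt_iff]
  obtain ⟨a, ha⟩ := hA
  exact ⟨(iSup_le fun i => ENNReal.ofReal_le_ofReal (ha (mem_range_self i))).trans_lt
    ENNReal.ofReal_lt_top, h⟩

end CZero

/-! ### The equivalences for `ℓ_q`-sums -/

section Lp

variable {q : ℝ≥0∞} [Fact (1 ≤ q)]

theorem tConst_lpSumMap_le [Nonempty ι] (A : ∀ i, X i →L[𝕜] Y i)
    (hA : BddAbove (range fun i => ‖A i‖)) (ξ : Ordinal.{u}) {p : ℝ} (hp : 0 < p)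
    (hpq : p ≤ q.toReal) (hq1 : 1 ≤ q.toReal) (hq : q ≠ ∞) :
    tConst ξ p (lpSumMap q A hA) ≤
      ⨆ i, max (ENNReal.ofReal (‖A i‖ ^ p)) (tConst ξ p (A i)) := by
  by_contra! hlt
  obtain ⟨C, hC0, hC, hC'⟩ := ENNReal.lt_iff_exists_real_btwn.1 hlt
  have hi := fun i => max_lt_iff.1 ((le_iSup (fun i => max (ENNReal.ofReal (‖A i‖ ^ p))
    (tConst ξ p (A i))) i).trans_lt hC)
  exact (tConst_lpSumMap_le_ofReal A hA hp hq1 hpq hq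
    (fun i => (ENNReal.ofReal_le_ofReal_iff hC0).1 (hi i).1.le) fun i => (hi i).2).not_gt hC'

theorem isAUSPowerType_of_tConst_lt_top {X Y : Type u} [NormedAddCommGroup X]
    [NormedSpace 𝕜 X] [NormedAddCommGroup Y] [NormedSpace 𝕜 Y] {A : X →L[𝕜] Y}
    {ξ : Ordinal.{u}} {p : ℝ} (hp : 1 ≤ p) (h : tConst ξ p A < ∞) : IsAUSPowerType ξ p A := by
  obtain ⟨C, -, hC, -⟩ := ENNReal.lt_iff_exists_real_btwn.1 h
  exact ⟨C, fun σ hσ _ => rhoMod_le_of_tConst_lt hp hC hσ⟩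

theorem isAUSPowerType_lpSumMap_of_iSup_lt_top [Nonempty ι] (A : ∀ i, X i →L[𝕜] Y i)
    (hA : BddAbove (range fun i => ‖A i‖)) {ξ : Ordinal.{u}} {p : ℝ} (hp : 1 ≤ p)
    (hpq : p ≤ q.toReal) (hq : q ≠ ∞) (h : (⨆ i, tConst ξ p (A i)) < ∞) :
    IsAUSPowerType ξ p (lpSumMap q A hA) := by
  have hp0 : 0 < p := zero_lt_one.trans_le hp
  refine isAUSPowerType_of_tConst_lt_top hp
    ((tConst_lpSumMap_le A hA ξ hp0 hpq (hp.trans hpq) hq).trans_lt ?_)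
  rw [iSup_sup_eq, sup_lt_iff]
  obtain ⟨a, ha⟩ := hA
  exact ⟨(iSup_le fun i => ENNReal.ofReal_le_ofReal (Real.rpow_le_rpow (norm_nonneg _)
    (ha (mem_range_self i)) hp0.le)).trans_lt ENNReal.ofReal_lt_top, h⟩

theorem iSup_rhoMod_div_lt_top_of_lpSumMap (A : ∀ i, X i →L[𝕜] Y i)
    (hA : BddAbove (range fun i => ‖A i‖)) {ξ : Ordinal.{u}} {p : ℝ}
    (h : IsAUSPowerType ξ p (lpSumMap q A hA)) :
    (⨆ (i : ι) (σ : ℝ) (_ : σ ∈ Ioo (0 : ℝ) 1),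
      rhoMod ξ (A i) σ / ((σ ^ p : ℝ) : EReal)) < ⊤ := by
  classical
  obtain ⟨C, hC⟩ := h
  refine lt_of_le_of_lt (iSup_le fun i => iSup₂_le fun σ hσ => ?_) (EReal.coe_lt_top C)
  have hσp : 0 < σ ^ p := Real.rpow_pos_of_pos hσ.1 p
  rw [EReal.div_le_iff_le_mul (by exact_mod_cast hσp) (EReal.coe_ne_top _), ← EReal.coe_mul,
    mul_comm]
  have hq0 : 0 < q := zero_lt_one.trans_le Fact.out
  exact rhoMod_le_of_isometry (lp.singleContinuousLinearMap 𝕜 X q i)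
    (lp.singleContinuousLinearMap 𝕜 Y q i) (lp.norm_single hq0 i) (lp.norm_single hq0 i)
    (lpSumMap_single A hA i) (hC σ hσ.1 hσ.2.le)

theorem iSup_tConst_lt_top_of_rhoMod_div (A : ∀ i, X i →L[𝕜] Y i)
    (hA : BddAbove (range fun i => ‖A i‖)) {ξ : Ordinal.{u}} {p : ℝ} (hp : 1 ≤ p)
    (h : (⨆ (i : ι) (σ : ℝ) (_ : σ ∈ Ioo (0 : ℝ) 1),
      rhoMod ξ (A i) σ / ((σ ^ p : ℝ) : EReal)) < ⊤) : (⨆ i, tConst ξ p (A i)) < ∞ := by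
  obtain ⟨D, hD, -⟩ := EReal.lt_iff_exists_real_btwn.1 h
  obtain ⟨a, ha⟩ := hA
  -- The bound `D` is only an extended real bound from above and might be negative, hence `max D 0`.
  refine lt_of_le_of_lt (iSup_le fun i => tConst_le_of_rhoMod_le hp (le_max_right D 0)
    (ha (mem_range_self i)) fun σ hσ => ?_) ENNReal.ofReal_lt_top
  have hσp : 0 < σ ^ p := Real.rpow_pos_of_pos hσ.1 p
  have hle : rhoMod ξ (A i) σ / ((σ ^ p : ℝ) : EReal) ≤ (D : EReal) :=
    (le_iSup_of_le i (le_iSup₂ (f := fun (σ : ℝ) (_ : σ ∈ Ioo (0 : ℝ) 1) =>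
      rhoMod ξ (A i) σ / ((σ ^ p : ℝ) : EReal)) σ hσ)).trans hD.le
  rw [EReal.div_le_iff_le_mul (by exact_mod_cast hσp) (EReal.coe_ne_top _), ← EReal.coe_mul] at hle
  refine hle.trans (EReal.coe_le_coe_iff.2 ?_)
  rw [mul_comm]
  exact mul_le_mul_of_nonneg_right (le_max_left _ _) hσp.le

end Lp

end Sums

end

theorem mainTheorem9 {𝕜 : Type v} [RCLike 𝕜] (ξ : Ordinal.{u}) {ι : Type u} [Nonempty ι]
    {X Y : ι → Type u}
    [∀ i, NormedAddCommGroup (X i)] [∀ i, NormedSpace 𝕜 (X i)] [∀ i, CompleteSpace (X i)]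
    [∀ i, NormedAddCommGroup (Y i)] [∀ i, NormedSpace 𝕜 (Y i)] [∀ i, CompleteSpace (Y i)]
    (A : ∀ i, X i →L[𝕜] Y i)
    (hSz : ∀ i, szlenk (A i) ≤ ((ω ^ (ξ + 1) : Ordinal.{u}) : WithTop Ordinal.{u}))
    (hA : BddAbove (range fun i => ‖A i‖)) :
    (∀ (p : ℝ) (q : ℝ≥0∞) [Fact (1 ≤ q)], 1 < p → ENNReal.ofReal p ≤ q → q ≠ ∞ →
      (IsAUSPowerType ξ p (lpSumMap q A hA) ↔
        (⨆ (i : ι) (σ : ℝ) (_ : σ ∈ Ioo (0 : ℝ) 1),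
          rhoMod ξ (A i) σ / ((σ ^ p : ℝ) : EReal)) < ⊤) ∧
      (IsAUSPowerType ξ p (lpSumMap q A hA) ↔ (⨆ i, tConst ξ p (A i)) < ∞) ∧
      tConst ξ p (lpSumMap q A hA) ≤
        ⨆ i, max (ENNReal.ofReal (‖A i‖ ^ p)) (tConst ξ p (A i))) ∧
    ((IsAUSPowerTypeTop ξ (c0SumMap A hA) ↔ (⨆ i, tConstTop ξ (A i)) < ∞) ∧
      tConstTop ξ (c0SumMap A hA) ≤
        ⨆ i, max (ENNReal.ofReal ‖A i‖) (tConstTop ξ (A i))) := by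
  refine ⟨fun p q _ hp hpq hq => ?_, isAUSPowerTypeTop_c0SumMap_iff A hA ξ,
    tConstTop_c0SumMap_le A hA ξ⟩
  have hpq' : p ≤ q.toReal := (ENNReal.ofReal_le_iff_le_toReal hq).1 hpq
  have hrho := iSup_rhoMod_div_lt_top_of_lpSumMap (q := q) A hA (ξ := ξ) (p := p)
  have ht := iSup_tConst_lt_top_of_rhoMod_div A hA (ξ := ξ) hp.le
  have haus := isAUSPowerType_lpSumMap_of_iSup_lt_top A hA (ξ := ξ) hp.le hpq' hq
  exact ⟨⟨hrho, fun h => haus (ht h)⟩, ⟨fun h => ht (hrho h), haus⟩,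
    tConst_lpSumMap_le A hA ξ (zero_lt_one.trans hp) hpq' (hp.le.trans hpq') hq⟩
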